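/- Let $\Bbbk$ be a field and let $\mathcal{C}=(\mathcal{C},\otimes,\mathbb{1},\alpha,l,r)$ be a rigid monoidal category whose underlying category is abelian and $\Bbbk$-linear. A Frobenius algebra $(A,m,u,\Delta,\varepsilon)$ in $\mathcal{C}$ is an algebra $(A,m,u)$ and a coalgebra $(A,\Delta,\varepsilon)$ with $(m\otimes \mathrm{id})\,\alpha^{-1}_{A,A,A}\,(\mathrm{id}\otimes\Delta)=\Delta m=(\mathrm{id}\otimes m)\,\alpha_{A,A,A}\,(\Delta\otimes \mathrm{id})$; it is special if $m\Delta=\mathrm{id}_A$ and $\varepsilon u=\varphi\,\mathrm{id}_{\mathbb{1}}$ for some nonzero $\varphi\in\Bbbk$. Let $A$ be a special Frobenius algebra in $\mathcal{C}$ and let ${}_A\mathcal{C}_A$ be the monoidal category of $A$-bimodules in $\mathcal{C}$, with tensor product $\otimes_A$ and unit object $A$. Let $\Phi:\mathcal{C}\to{}_A\mathcal{C}_A$ be the functor $X\mapsto (A\otimes X)\otimes A$, $f\mapsto(\mathrm{id}_A\otimes f)\otimes\mathrm{id}_A$, where the bimodule actions multiply on the outer factors. It is a (lax) monoidal functor: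 $\Phi(X)\otimes_A\Phi(Y)\to\Phi(X\otimes Y)$ is induced by applying $\varepsilon m:A\otimes A\to\mathbb{1}$ to the two inner factors $A$ of $((A\otimes X)\otimes A)\otimes((A\otimes Y)\otimes A)$, and $A\to\Phi(\mathbb{1})$ is $(r_A^{-1}\otimes\mathrm{id}_A)\Delta$. Hence $\Phi$ sends algebras in $\mathcal{C}$ to algebras in ${}_A\mathcal{C}_A$. Two algebras $S,S'$ in a monoidal category $\mathcal{T}$ are called Morita equivalent in $\mathcal{T}$ if their categories of right modules $\mathcal{T}_S$ and $\mathcal{T}_{S'}$ are equivalent as left $\mathcal{T}$-module categories. Theorem. For all algebras $B,B'$ in $\mathcal{C}$: $B$ and $B'$ are Morita equivalent in $\mathcal{C}$ if and only if $\Phi(B)$ and $\Phi(B')$ are Morita equivalent in ${}_A\mathcal{C}_A$. -/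

import Mathlib

open CategoryTheory CategoryTheory.Limits MonoidalCategory

section Rigid

/-! In a rigid monoidal category the functors `X ⊗ -` and `- ⊗ X` have right adjoints. -/

instance instPreservesTensorLeftOfLeftRigid {C : Type*} [Category* C] [MonoidalCategory C]
    [LeftRigidCategory C] (X : C) : PreservesColimitsOfSize.{0, 0} (tensorLeft X) :=
  (tensorLeftAdjunction (HasLeftDual.leftDual X) X).leftAdjoint_preservesColimits

instance instPreservesTensorRightOfRightRigid {C : Type*} [Category* C] [MonoidalCategory C]
    [RightRigidCategory C] (X : C) : PreservesColimitsOfSize.{0, 0} (tensorRight X) :=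
  (tensorRightAdjunction X (HasRightDual.rightDual X)).leftAdjoint_preservesColimits

end Rigid

/-! ### Right modules over an algebra, as a left module category -/

/-- A right module over the algebra `A` in the monoidal category `C`. -/
structure RightMod {C : Type*} [Category* C] [MonoidalCategory C] (A : Mon C) where
  /-- The underlying object. -/
  X : C
  /-- The right action. -/
  act : X ⊗ A.X ⟶ X
  act_one : X ◁ MonObj.one ≫ act = (ρ_ X).hom
  act_act : act ▷ A.X ≫ act = (α_ X A.X A.X).hom ≫ X ◁ MonObj.mul ≫ act

namespace RightMod

open MonObj

variable {C : Type*} [Category* C] [MonoidalCategory C] {A : Mon C}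

/-- A morphism of right `A`-modules. -/
@[ext]
structure Hom (M N : RightMod A) where
  /-- The underlying morphism of `C`. -/
  hom : M.X ⟶ N.X
  act_hom : M.act ≫ hom = hom ▷ A.X ≫ N.act

instance : Category (RightMod A) where
  Hom M N := Hom M N
  id M := ⟨𝟙 M.X, by simp⟩
  comp f g := ⟨f.hom ≫ g.hom, by
    rw [comp_whiskerRight, Category.assoc, ← g.act_hom, ← Category.assoc, f.act_hom,
      Category.assoc]⟩

@[ext]
lemma hom_ext {M N : RightMod A} (f g : M ⟶ N) (h : f.hom = g.hom) : f = g :=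
  Hom.ext h

@[simp]
lemma id_hom (M : RightMod A) : Hom.hom (𝟙 M) = 𝟙 M.X := rfl

@[simp]
lemma comp_hom {M N K : RightMod A} (f : M ⟶ N) (g : N ⟶ K) :
    (f ≫ g).hom = f.hom ≫ g.hom := rfl

/-- An isomorphism of right modules from an isomorphism in `C` that is a module map. -/
def mkIso {M N : RightMod A} (e : M.X ≅ N.X) (h : M.act ≫ e.hom = e.hom ▷ A.X ≫ N.act) :
    M ≅ N where
  hom := ⟨e.hom, h⟩
  inv := ⟨e.inv, by
    rw [← cancel_mono e.hom, Category.assoc, Category.assoc, h, ← comp_whiskerRight_assoc]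
    simp⟩
  hom_inv_id := by ext; simp
  inv_hom_id := by ext; simp

@[simp]
lemma mkIso_hom_hom {M N : RightMod A} (e : M.X ≅ N.X)
    (h : M.act ≫ e.hom = e.hom ▷ A.X ≫ N.act) : (mkIso e h).hom.hom = e.hom := rfl

@[simp]
lemma mkIso_inv_hom {M N : RightMod A} (e : M.X ≅ N.X)
    (h : M.act ≫ e.hom = e.hom ▷ A.X ≫ N.act) : (mkIso e h).inv.hom = e.inv := rfl

/-- The right module `X ⊗ M`, with the action of `A` on the factor `M`. -/
@[simps]
def tensorObj (X : C) (M : RightMod A) : RightMod A where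
  X := X ⊗ M.X
  act := (α_ X M.X A.X).hom ≫ X ◁ M.act
  act_one := by
    rw [associator_naturality_right_assoc, ← whiskerLeft_comp, M.act_one]
    monoidal
  act_act := by
    simp only [comp_whiskerRight, whisker_assoc, Category.assoc, Iso.inv_hom_id_assoc,
      ← whiskerLeft_comp, M.act_act]
    simp

/-- The category `C_A` of right `A`-modules is a left `C`-module category. -/
instance instMonoidalLeftAction : MonoidalLeftAction C (RightMod A) where
  actionObj X M := tensorObj X M
  actionHomLeft {X Y} f M := ⟨f ▷ M.X, by
    change ((α_ X M.X A.X).hom ≫ X ◁ M.act) ≫ f ▷ M.X =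
      f ▷ M.X ▷ A.X ≫ (α_ Y M.X A.X).hom ≫ Y ◁ M.act
    rw [associator_naturality_left_assoc, ← whisker_exchange, Category.assoc]⟩
  actionHomRight X {M N} f := ⟨X ◁ f.hom, by
    change ((α_ X M.X A.X).hom ≫ X ◁ M.act) ≫ X ◁ f.hom =
      (X ◁ f.hom) ▷ A.X ≫ (α_ X N.X A.X).hom ≫ X ◁ N.act
    rw [associator_naturality_middle_assoc, Category.assoc, ← MonoidalCategory.whiskerLeft_comp,
      ← MonoidalCategory.whiskerLeft_comp, f.act_hom]⟩
  actionHom {X Y M N} f g := ⟨f ⊗ₘ g.hom, by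
    change ((α_ X M.X A.X).hom ≫ X ◁ M.act) ≫ (f ⊗ₘ g.hom) =
      (f ⊗ₘ g.hom) ▷ A.X ≫ (α_ Y N.X A.X).hom ≫ Y ◁ N.act
    rw [MonoidalCategory.tensorHom_def, comp_whiskerRight, Category.assoc, Category.assoc,
      associator_naturality_middle_assoc, associator_naturality_left_assoc,
      whisker_exchange_assoc, ← MonoidalCategory.whiskerLeft_comp,
      ← MonoidalCategory.whiskerLeft_comp, g.act_hom]⟩
  actionAssocIso X Y M := mkIso (α_ X Y M.X) (by
    change ((α_ (X ⊗ Y) M.X A.X).hom ≫ (X ⊗ Y) ◁ M.act) ≫ (α_ X Y M.X).hom =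
      (α_ X Y M.X).hom ▷ A.X ≫ (α_ X (Y ⊗ M.X) A.X).hom ≫
        X ◁ ((α_ Y M.X A.X).hom ≫ Y ◁ M.act)
    simp)
  actionUnitIso M := mkIso (λ_ M.X) (by
    change ((α_ (𝟙_ C) M.X A.X).hom ≫ 𝟙_ C ◁ M.act) ≫ (λ_ M.X).hom = (λ_ M.X).hom ▷ A.X ≫ M.act
    simp)
  actionHom_def f g := by
    ext; exact MonoidalCategory.tensorHom_def f g.hom
  actionHomRight_id X M := by
    ext; exact MonoidalCategory.whiskerLeft_id X M.X
  id_actionHomLeft X M := by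
    ext; exact MonoidalCategory.id_whiskerRight X M.X
  actionHom_comp f₁ f₂ g₁ g₂ := by
    ext; exact (tensorHom_comp_tensorHom f₁ g₁.hom f₂ g₂.hom).symm
  actionAssocIso_hom_naturality f g h := by
    ext; exact MonoidalCategory.associator_naturality f g h.hom
  actionUnitIso_hom_naturality f := by
    ext; exact (MonoidalCategory.leftUnitor_naturality f.hom).symm
  whiskerLeft_actionHomLeft X _ _ f M := by
    ext; exact whisker_assoc X f M.X
  whiskerRight_actionHomLeft {X X'} Y f M := by
    ext
    change (f ▷ Y) ▷ M.X = (α_ X Y M.X).hom ≫ f ▷ (Y ⊗ M.X) ≫ (α_ X' Y M.X).inv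
    simp
  associator_actionHom X Y Z M := by
    ext; exact MonoidalCategory.pentagon X Y Z M.X
  leftUnitor_actionHom X M := by
    ext
    change (λ_ X).hom ▷ M.X = (α_ (𝟙_ C) X M.X).hom ≫ (λ_ (X ⊗ M.X)).hom
    simp
  rightUnitor_actionHom X M := by
    ext
    change (ρ_ X).hom ▷ M.X = (α_ X (𝟙_ C) M.X).hom ≫ X ◁ (λ_ M.X).hom
    simp

end RightMod

/-- Two algebras `A`, `B` in a monoidal category `C` are Morita equivalent if there is an
equivalence `C_A ⥤ C_B` of left `C`-module categories, that is, a `C`-module functor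
(with invertible structure morphisms) that is an equivalence of categories. -/
def MoritaEquivalent {C : Type*} [Category* C] [MonoidalCategory C] (A B : Mon C) : Prop :=
  ∃ F : RightMod A ⥤ RightMod B, F.IsEquivalence ∧ Nonempty (F.LeftLinear C)

/-! ### The monoidal category of bimodules -/

namespace Bimod

variable {C : Type*} [Category* C] [MonoidalCategory C] [HasCoequalizers C]
  [∀ X : C, PreservesColimitsOfSize.{0, 0} (tensorLeft X)]
  [∀ X : C, PreservesColimitsOfSize.{0, 0} (tensorRight X)]

/-- The monoidal category `_A C_A` of `A`-bimodules, with tensor product `⊗_A` (the coequalizer of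
the two inner actions) and unit object `A`. -/
noncomputable instance instMonoidalCategory (A : Mon C) : MonoidalCategory (Bimod A A) where
  tensorObj M N := tensorBimod M N
  whiskerLeft M _ _ f := whiskerLeft M f
  whiskerRight f N := whiskerRight f N
  tensorUnit := regular A
  associator := associatorBimod
  leftUnitor := leftUnitorBimod
  rightUnitor := rightUnitorBimod
  whiskerLeft_id _ _ := whiskerLeft_id_bimod
  id_whiskerRight _ _ := id_whiskerRight_bimod
  tensorHom_comp_tensorHom {M₁ N₁ P₁ M₂ N₂ P₂} f₁ f₂ g₁ g₂ := by
    change (whiskerRight f₁ M₂ ≫ whiskerLeft N₁ f₂) ≫ whiskerRight g₁ N₂ ≫ whiskerLeft P₁ g₂ =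
      whiskerRight (f₁ ≫ g₁) M₂ ≫ whiskerLeft P₁ (f₂ ≫ g₂)
    rw [whiskerLeft_comp_bimod, comp_whiskerRight_bimod, Category.assoc, Category.assoc,
      ← Category.assoc (whiskerLeft N₁ f₂), whisker_exchange_bimod, Category.assoc]
  id_tensorHom_id M N := by
    change whiskerRight (𝟙 M) N ≫ whiskerLeft M (𝟙 N) = 𝟙 _
    rw [whiskerLeft_id_bimod, id_whiskerRight_bimod, Category.comp_id]
  associator_naturality {M₁ M₂ M₃ N₁ N₂ N₃} f₁ f₂ f₃ := by
    change (whiskerRight (whiskerRight f₁ M₂ ≫ whiskerLeft N₁ f₂) M₃ ≫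
        whiskerLeft (tensorBimod N₁ N₂) f₃) ≫ (associatorBimod N₁ N₂ N₃).hom =
      (associatorBimod M₁ M₂ M₃).hom ≫ whiskerRight f₁ (tensorBimod M₂ M₃) ≫
        whiskerLeft N₁ (whiskerRight f₂ M₃ ≫ whiskerLeft N₂ f₃)
    rw [comp_whiskerRight_bimod, comp_whiskerLeft_bimod, whisker_assoc_bimod,
      whiskerRight_comp_bimod, whiskerLeft_comp_bimod]
    simp only [Category.assoc, Iso.inv_hom_id, Iso.hom_inv_id_assoc,
      Iso.inv_hom_id_assoc, Category.comp_id]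
  leftUnitor_naturality {M N} f := by
    rw [id_whiskerLeft_bimod]
    simp only [Category.assoc, Iso.inv_hom_id, Category.comp_id]
  rightUnitor_naturality {M N} f := by
    rw [whiskerRight_id_bimod]
    simp only [Category.assoc, Iso.inv_hom_id, Category.comp_id]
  pentagon := pentagon_bimod
  triangle := triangle_bimod

/-- The projection `M ⊗ N ⟶ M ⊗_A N`. -/
noncomputable def proj {A : Mon C} (M N : Bimod A A) : M.X ⊗ N.X ⟶ (M ⊗ N).X :=
  coequalizer.π (M.actRight ▷ N.X) ((α_ _ _ _).hom ≫ M.X ◁ N.actLeft)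

section proj

variable {A : Mon C}

instance (M N : Bimod A A) : Epi (proj M N) :=
  inferInstanceAs (Epi (coequalizer.π _ _))

instance (Z : C) (M N : Bimod A A) : Epi (Z ◁ proj M N) :=
  inferInstanceAs (Epi ((tensorLeft Z).map (proj M N)))

instance (Z : C) (M N : Bimod A A) : Epi (proj M N ▷ Z) :=
  inferInstanceAs (Epi ((tensorRight Z).map (proj M N)))

lemma proj_actLeft (M N : Bimod A A) :
    A.X ◁ proj M N ≫ (M ⊗ N).actLeft = (α_ _ _ _).inv ≫ M.actLeft ▷ N.X ≫ proj M N :=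
  TensorBimod.whiskerLeft_π_actLeft M N

lemma proj_actRight (M N : Bimod A A) :
    proj M N ▷ A.X ≫ (M ⊗ N).actRight = (α_ _ _ _).hom ≫ M.X ◁ N.actRight ≫ proj M N :=
  TensorBimod.π_tensor_id_actRight M N

lemma proj_whiskerLeft (M : Bimod A A) {N N' : Bimod A A} (f : N ⟶ N') :
    proj M N ≫ (M ◁ f).hom = M.X ◁ f.hom ≫ proj M N' :=
  ι_colimMap _ _

lemma proj_whiskerRight {M M' : Bimod A A} (f : M ⟶ M') (N : Bimod A A) :
    proj M N ≫ (f ▷ N).hom = f.hom ▷ N.X ≫ proj M' N :=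
  ι_colimMap _ _

lemma proj_associator (M N P : Bimod A A) :
    proj M N ▷ P.X ≫ proj (M ⊗ N) P ≫ (α_ M N P).hom.hom =
      (α_ M.X N.X P.X).hom ≫ M.X ◁ proj N P ≫ proj M (N ⊗ P) := by
  have h : proj (M ⊗ N) P ≫ (α_ M N P).hom.hom = AssociatorBimod.homAux M N P :=
    coequalizer.π_desc _ _
  rw [h]
  exact π_tensor_id_preserves_coequalizer_inv_desc _ _ _ _

lemma proj_leftUnitor (M : Bimod A A) : proj (𝟙_ _) M ≫ (λ_ M).hom.hom = M.actLeft :=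
  coequalizer.π_desc _ _

lemma proj_rightUnitor (M : Bimod A A) : proj M (𝟙_ _) ≫ (ρ_ M).hom.hom = M.actRight :=
  coequalizer.π_desc _ _

/-- The morphism `M ⊗_A N ⟶ Z` in `C` induced by an `A`-balanced morphism `M ⊗ N ⟶ Z`. -/
noncomputable def desc {M N : Bimod A A} {Z : C} (f : M.X ⊗ N.X ⟶ Z)
    (h : M.actRight ▷ N.X ≫ f = (α_ _ _ _).hom ≫ M.X ◁ N.actLeft ≫ f) : (M ⊗ N).X ⟶ Z :=
  coequalizer.desc f (by rw [h, Category.assoc])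

lemma proj_desc {M N : Bimod A A} {Z : C} (f : M.X ⊗ N.X ⟶ Z)
    (h : M.actRight ▷ N.X ≫ f = (α_ _ _ _).hom ≫ M.X ◁ N.actLeft ≫ f) :
    proj M N ≫ desc f h = f :=
  coequalizer.π_desc _ _

/-- The bimodule map `M ⊗_A N ⟶ P` induced by an `A`-balanced map `M ⊗ N ⟶ P` that commutes with
the outer actions. -/
noncomputable def lift {M N P : Bimod A A} (f : M.X ⊗ N.X ⟶ P.X)
    (h : M.actRight ▷ N.X ≫ f = (α_ _ _ _).hom ≫ M.X ◁ N.actLeft ≫ f)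
    (hl : M.actLeft ▷ N.X ≫ f = (α_ _ _ _).hom ≫ A.X ◁ f ≫ P.actLeft)
    (hr : M.X ◁ N.actRight ≫ f = (α_ _ _ _).inv ≫ f ▷ A.X ≫ P.actRight) : M ⊗ N ⟶ P where
  hom := desc f h
  left_act_hom := by
    rw [← cancel_epi (A.X ◁ proj M N), reassoc_of% @Bimod.proj_actLeft, proj_desc, hl, Iso.inv_hom_id_assoc,
      ← MonoidalCategory.whiskerLeft_comp_assoc, proj_desc]
  right_act_hom := by
    rw [← cancel_epi (proj M N ▷ A.X), reassoc_of% @Bimod.proj_actRight, proj_desc, hr, Iso.hom_inv_id_assoc,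
      ← comp_whiskerRight_assoc, proj_desc]

lemma proj_lift {M N P : Bimod A A} (f : M.X ⊗ N.X ⟶ P.X)
    (h : M.actRight ▷ N.X ≫ f = (α_ _ _ _).hom ≫ M.X ◁ N.actLeft ≫ f)
    (hl : M.actLeft ▷ N.X ≫ f = (α_ _ _ _).hom ≫ A.X ◁ f ≫ P.actLeft)
    (hr : M.X ◁ N.actRight ≫ f = (α_ _ _ _).inv ≫ f ▷ A.X ≫ P.actRight) :
    proj M N ≫ (lift f h hl hr).hom = f :=
  coequalizer.π_desc _ _

end proj

end Bimod

/-! ### Frobenius algebras and the free bimodule functor -/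

section

open MonObj ComonObj

/-- A Frobenius algebra in a monoidal category. -/
structure FrobAlg (C : Type*) [Category* C] [MonoidalCategory C] where
  /-- The underlying object. -/
  X : C
  [mon : MonObj X]
  [comon : ComonObj X]
  frobenius_left : X ◁ Δ[X] ≫ (α_ X X X).inv ≫ μ[X] ▷ X = μ[X] ≫ Δ[X]
  frobenius_right : Δ[X] ▷ X ≫ (α_ X X X).hom ≫ X ◁ μ[X] = μ[X] ≫ Δ[X]

end

namespace FrobAlg

attribute [instance] mon comon

section

open MonObj ComonObj

variable {C : Type*} [Category* C] [MonoidalCategory C] (A : FrobAlg C)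

/-- The algebra underlying a Frobenius algebra. -/
abbrev alg : Mon C := ⟨A.X⟩

/-- The free bimodule `(A ⊗ X) ⊗ A`. -/
@[simps]
def freeObj (X : C) : Bimod A.alg A.alg where
  X := (A.X ⊗ X) ⊗ A.X
  actLeft := (α_ A.X (A.X ⊗ X) A.X).inv ≫ ((α_ A.X A.X X).inv ≫ μ[A.X] ▷ X) ▷ A.X
  actRight := (α_ (A.X ⊗ X) A.X A.X).hom ≫ (A.X ⊗ X) ◁ μ[A.X]
  one_actLeft := by
    change η[A.X] ▷ ((A.X ⊗ X) ⊗ A.X) ≫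
      (α_ A.X (A.X ⊗ X) A.X).inv ≫ ((α_ A.X A.X X).inv ≫ μ[A.X] ▷ X) ▷ A.X = _
    calc _ = 𝟙 _ ⊗≫ (η[A.X] ▷ A.X ≫ μ[A.X]) ▷ (X ⊗ A.X) ⊗≫ 𝟙 _ := by monoidal
      _ = _ := by rw [MonObj.one_mul]; monoidal
  left_assoc := by
    change μ[A.X] ▷ ((A.X ⊗ X) ⊗ A.X) ≫
      (α_ A.X (A.X ⊗ X) A.X).inv ≫ ((α_ A.X A.X X).inv ≫ μ[A.X] ▷ X) ▷ A.X =
      (α_ A.X A.X ((A.X ⊗ X) ⊗ A.X)).hom ≫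
      A.X ◁ ((α_ A.X (A.X ⊗ X) A.X).inv ≫ ((α_ A.X A.X X).inv ≫ μ[A.X] ▷ X) ▷ A.X) ≫
      ((α_ A.X (A.X ⊗ X) A.X).inv ≫ ((α_ A.X A.X X).inv ≫ μ[A.X] ▷ X) ▷ A.X)
    calc _ = 𝟙 _ ⊗≫ (μ[A.X] ▷ A.X ≫ μ[A.X]) ▷ (X ⊗ A.X) ⊗≫ 𝟙 _ := by monoidal
      _ = _ := by rw [MonObj.mul_assoc]; monoidal
  actRight_one := by
    change ((A.X ⊗ X) ⊗ A.X) ◁ η[A.X] ≫ (α_ (A.X ⊗ X) A.X A.X).hom ≫ (A.X ⊗ X) ◁ μ[A.X] = _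
    calc _ = 𝟙 _ ⊗≫ (A.X ⊗ X) ◁ (A.X ◁ η[A.X] ≫ μ[A.X]) ⊗≫ 𝟙 _ := by monoidal
      _ = _ := by rw [MonObj.mul_one]; monoidal
  right_assoc := by
    change ((A.X ⊗ X) ⊗ A.X) ◁ μ[A.X] ≫ (α_ (A.X ⊗ X) A.X A.X).hom ≫ (A.X ⊗ X) ◁ μ[A.X] =
      (α_ ((A.X ⊗ X) ⊗ A.X) A.X A.X).inv ≫
      ((α_ (A.X ⊗ X) A.X A.X).hom ≫ (A.X ⊗ X) ◁ μ[A.X]) ▷ A.X ≫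
      (α_ (A.X ⊗ X) A.X A.X).hom ≫ (A.X ⊗ X) ◁ μ[A.X]
    symm
    calc _ = 𝟙 _ ⊗≫ (A.X ⊗ X) ◁ (μ[A.X] ▷ A.X ≫ μ[A.X]) ⊗≫ 𝟙 _ := by monoidal
      _ = _ := by rw [MonObj.mul_assoc]; monoidal
  middle_assoc := by
    change ((α_ A.X (A.X ⊗ X) A.X).inv ≫ ((α_ A.X A.X X).inv ≫ μ[A.X] ▷ X) ▷ A.X) ▷ A.X ≫
      (α_ (A.X ⊗ X) A.X A.X).hom ≫ (A.X ⊗ X) ◁ μ[A.X] =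
      (α_ A.X ((A.X ⊗ X) ⊗ A.X) A.X).hom ≫
      A.X ◁ ((α_ (A.X ⊗ X) A.X A.X).hom ≫ (A.X ⊗ X) ◁ μ[A.X]) ≫
      (α_ A.X (A.X ⊗ X) A.X).inv ≫ ((α_ A.X A.X X).inv ≫ μ[A.X] ▷ X) ▷ A.X
    calc _ = 𝟙 _ ⊗≫ (μ[A.X] ▷ (X ⊗ A.X ⊗ A.X) ≫ A.X ◁ (X ◁ μ[A.X])) ⊗≫ 𝟙 _ := by monoidal
      _ = _ := by rw [← whisker_exchange]; monoidal

/-- The functor `Φ : C ⥤ _A C_A`, `X ↦ (A ⊗ X) ⊗ A`. -/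
@[simps]
def free : C ⥤ Bimod A.alg A.alg where
  obj X := A.freeObj X
  map {X Y} f :=
    { hom := (A.X ◁ f) ▷ A.X
      left_act_hom := by
        change ((α_ A.X (A.X ⊗ X) A.X).inv ≫ ((α_ A.X A.X X).inv ≫ μ[A.X] ▷ X) ▷ A.X) ≫
          (A.X ◁ f) ▷ A.X = A.X ◁ (A.X ◁ f) ▷ A.X ≫
          (α_ A.X (A.X ⊗ Y) A.X).inv ≫ ((α_ A.X A.X Y).inv ≫ μ[A.X] ▷ Y) ▷ A.X
        calc _ = 𝟙 _ ⊗≫ (μ[A.X] ▷ X ≫ A.X ◁ f) ▷ A.X ⊗≫ 𝟙 _ := by monoidal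
          _ = _ := by rw [← whisker_exchange]; monoidal
      right_act_hom := by
        change ((α_ (A.X ⊗ X) A.X A.X).hom ≫ (A.X ⊗ X) ◁ μ[A.X]) ≫ (A.X ◁ f) ▷ A.X =
          (A.X ◁ f) ▷ A.X ▷ A.X ≫ (α_ (A.X ⊗ Y) A.X A.X).hom ≫ (A.X ⊗ Y) ◁ μ[A.X]
        rw [Category.assoc, whisker_exchange]
        monoidal }
  map_id X := by
    ext
    change (A.X ◁ 𝟙 X) ▷ A.X = 𝟙 ((A.X ⊗ X) ⊗ A.X)
    simp
  map_comp {X Y Z} f g := by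
    ext
    change (A.X ◁ (f ≫ g)) ▷ A.X = (A.X ◁ f) ▷ A.X ≫ (A.X ◁ g) ▷ A.X
    simp

/-- The morphism `Φ(X) ⊗ Φ(Y) ⟶ Φ(X ⊗ Y)` in `C` that applies `ε ∘ μ` to the two inner factors
`A`. -/
def freeMulAux (X Y : C) :
    ((A.X ⊗ X) ⊗ A.X) ⊗ ((A.X ⊗ Y) ⊗ A.X) ⟶ (A.X ⊗ (X ⊗ Y)) ⊗ A.X :=
  (α_ ((A.X ⊗ X) ⊗ A.X) (A.X ⊗ Y) A.X).inv ≫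
    (α_ (A.X ⊗ X) A.X (A.X ⊗ Y)).hom ▷ A.X ≫
    ((A.X ⊗ X) ◁ (α_ A.X A.X Y).inv) ▷ A.X ≫
    ((A.X ⊗ X) ◁ ((μ[A.X] ≫ ε[A.X]) ▷ Y)) ▷ A.X ≫
    ((A.X ⊗ X) ◁ (λ_ Y).hom) ▷ A.X ≫
    (α_ A.X X Y).hom ▷ A.X

lemma freeMulAux_eq (X Y : C) : A.freeMulAux X Y =
    𝟙 _ ⊗≫ (A.X ⊗ X) ◁ (μ[A.X] ≫ ε[A.X]) ▷ (Y ⊗ A.X) ⊗≫ 𝟙 _ := by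
  rw [freeMulAux]
  generalize μ[A.X] ≫ ε[A.X] = p
  monoidal

/-- The multiplication followed by the counit is an invariant pairing. -/
lemma pairing_assoc : μ[A.X] ▷ A.X ≫ μ[A.X] ≫ ε[A.X] =
    (α_ A.X A.X A.X).hom ≫ A.X ◁ μ[A.X] ≫ μ[A.X] ≫ ε[A.X] := by
  rw [MonObj.mul_assoc_assoc]

lemma comul_pairing : A.X ◁ Δ[A.X] ≫ (α_ A.X A.X A.X).inv ≫ (μ[A.X] ≫ ε[A.X]) ▷ A.X =
    μ[A.X] ≫ (λ_ A.X).inv := by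
  rw [comp_whiskerRight, reassoc_of% A.frobenius_left, ComonObj.counit_comul]

lemma comul_pairing' : Δ[A.X] ▷ A.X ≫ (α_ A.X A.X A.X).hom ≫ A.X ◁ (μ[A.X] ≫ ε[A.X]) =
    μ[A.X] ≫ (ρ_ A.X).inv := by
  rw [MonoidalCategory.whiskerLeft_comp, reassoc_of% A.frobenius_right, ComonObj.comul_counit]

lemma freeMulAux_balanced (X Y : C) :
    ((α_ (A.X ⊗ X) A.X A.X).hom ≫ (A.X ⊗ X) ◁ μ[A.X]) ▷ ((A.X ⊗ Y) ⊗ A.X) ≫ A.freeMulAux X Y =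
      (α_ ((A.X ⊗ X) ⊗ A.X) A.X ((A.X ⊗ Y) ⊗ A.X)).hom ≫ ((A.X ⊗ X) ⊗ A.X) ◁
        ((α_ A.X (A.X ⊗ Y) A.X).inv ≫ ((α_ A.X A.X Y).inv ≫ μ[A.X] ▷ Y) ▷ A.X) ≫
        A.freeMulAux X Y := by
  rw [freeMulAux_eq]
  have h := A.pairing_assoc
  generalize μ[A.X] ≫ ε[A.X] = p at *
  calc _ = 𝟙 _ ⊗≫ (A.X ⊗ X) ◁ (μ[A.X] ▷ A.X ≫ p) ▷ (Y ⊗ A.X) ⊗≫ 𝟙 _ := by monoidal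
    _ = _ := by rw [h]; monoidal

lemma freeMulAux_left (X Y : C) :
    ((α_ A.X (A.X ⊗ X) A.X).inv ≫ ((α_ A.X A.X X).inv ≫ μ[A.X] ▷ X) ▷ A.X) ▷
        ((A.X ⊗ Y) ⊗ A.X) ≫ A.freeMulAux X Y =
      (α_ A.X ((A.X ⊗ X) ⊗ A.X) ((A.X ⊗ Y) ⊗ A.X)).hom ≫ A.X ◁ A.freeMulAux X Y ≫
        (α_ A.X (A.X ⊗ (X ⊗ Y)) A.X).inv ≫
          ((α_ A.X A.X (X ⊗ Y)).inv ≫ μ[A.X] ▷ (X ⊗ Y)) ▷ A.X := by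
  rw [freeMulAux_eq]
  generalize μ[A.X] ≫ ε[A.X] = p
  calc _ = 𝟙 _ ⊗≫ (μ[A.X] ▷ (X ⊗ (A.X ⊗ A.X) ⊗ Y ⊗ A.X) ≫ A.X ◁ (X ◁ p ▷ (Y ⊗ A.X))) ⊗≫ 𝟙 _ := by
        monoidal
    _ = _ := by rw [← whisker_exchange]; monoidal

lemma freeMulAux_right (X Y : C) :
    ((A.X ⊗ X) ⊗ A.X) ◁ ((α_ (A.X ⊗ Y) A.X A.X).hom ≫ (A.X ⊗ Y) ◁ μ[A.X]) ≫
        A.freeMulAux X Y =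
      (α_ ((A.X ⊗ X) ⊗ A.X) ((A.X ⊗ Y) ⊗ A.X) A.X).inv ≫ A.freeMulAux X Y ▷ A.X ≫
        (α_ (A.X ⊗ (X ⊗ Y)) A.X A.X).hom ≫ (A.X ⊗ (X ⊗ Y)) ◁ μ[A.X] := by
  rw [freeMulAux_eq]
  generalize μ[A.X] ≫ ε[A.X] = p
  calc _ = 𝟙 _ ⊗≫ ((A.X ⊗ X ⊗ (A.X ⊗ A.X) ⊗ Y) ◁ μ[A.X] ≫ (A.X ◁ (X ◁ (p ▷ Y))) ▷ A.X) ⊗≫ 𝟙 _ := by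
        monoidal
    _ = _ := by rw [whisker_exchange]; monoidal

lemma freeMulAux_natural_left {X X' : C} (f : X ⟶ X') (Y : C) :
    ((A.X ◁ f) ▷ A.X) ▷ ((A.X ⊗ Y) ⊗ A.X) ≫ A.freeMulAux X' Y =
      A.freeMulAux X Y ≫ (A.X ◁ (f ▷ Y)) ▷ A.X := by
  rw [freeMulAux_eq, freeMulAux_eq]
  generalize μ[A.X] ≫ ε[A.X] = p
  calc _ = 𝟙 _ ⊗≫ A.X ◁ (f ▷ (A.X ⊗ A.X) ≫ X' ◁ p) ▷ (Y ⊗ A.X) ⊗≫ 𝟙 _ := by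
        monoidal
    _ = _ := by rw [← whisker_exchange]; monoidal

lemma freeMulAux_natural_right (X : C) {Y Y' : C} (f : Y ⟶ Y') :
    ((A.X ⊗ X) ⊗ A.X) ◁ ((A.X ◁ f) ▷ A.X) ≫ A.freeMulAux X Y' =
      A.freeMulAux X Y ≫ (A.X ◁ (X ◁ f)) ▷ A.X := by
  rw [freeMulAux_eq, freeMulAux_eq]
  generalize μ[A.X] ≫ ε[A.X] = p
  calc _ = 𝟙 _ ⊗≫ (A.X ⊗ X) ◁ ((A.X ⊗ A.X) ◁ f ≫ p ▷ Y') ▷ A.X ⊗≫ 𝟙 _ := by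
        monoidal
    _ = _ := by rw [whisker_exchange]; monoidal

lemma freeMulAux_assoc (X Y Z : C) :
    A.freeMulAux X Y ▷ ((A.X ⊗ Z) ⊗ A.X) ≫ A.freeMulAux (X ⊗ Y) Z ≫
        (A.X ◁ (α_ X Y Z).hom) ▷ A.X =
      (α_ ((A.X ⊗ X) ⊗ A.X) ((A.X ⊗ Y) ⊗ A.X) ((A.X ⊗ Z) ⊗ A.X)).hom ≫
        ((A.X ⊗ X) ⊗ A.X) ◁ A.freeMulAux Y Z ≫ A.freeMulAux X (Y ⊗ Z) := by
  rw [freeMulAux_eq, freeMulAux_eq, freeMulAux_eq, freeMulAux_eq]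
  generalize μ[A.X] ≫ ε[A.X] = p
  calc _ = 𝟙 _ ⊗≫ (A.X ⊗ X) ◁ (p ▷ (Y ⊗ A.X ⊗ A.X) ≫ 𝟙_ C ◁ (Y ◁ p)) ▷ (Z ⊗ A.X) ⊗≫ 𝟙 _ := by
        monoidal
    _ = _ := by rw [← whisker_exchange]; monoidal

/-- The morphism `A ⟶ Φ(𝟙)` in `C` given by the comultiplication. -/
def freeOneAux : A.X ⟶ (A.X ⊗ 𝟙_ C) ⊗ A.X := Δ[A.X] ≫ (ρ_ A.X).inv ▷ A.X

lemma freeOneAux_left :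
    μ[A.X] ≫ A.freeOneAux = A.X ◁ A.freeOneAux ≫
      (α_ A.X (A.X ⊗ 𝟙_ C) A.X).inv ≫ ((α_ A.X A.X (𝟙_ C)).inv ≫ μ[A.X] ▷ (𝟙_ C)) ▷ A.X := by
  rw [freeOneAux, ← Category.assoc, ← A.frobenius_left]
  monoidal

lemma freeOneAux_right :
    μ[A.X] ≫ A.freeOneAux = A.freeOneAux ▷ A.X ≫
      (α_ (A.X ⊗ 𝟙_ C) A.X A.X).hom ≫ (A.X ⊗ 𝟙_ C) ◁ μ[A.X] := by
  rw [freeOneAux, ← Category.assoc, ← A.frobenius_right]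
  monoidal

lemma freeMulAux_left_unit (X : C) :
    (α_ A.X (A.X ⊗ X) A.X).inv ≫ ((α_ A.X A.X X).inv ≫ μ[A.X] ▷ X) ▷ A.X =
      A.freeOneAux ▷ ((A.X ⊗ X) ⊗ A.X) ≫ A.freeMulAux (𝟙_ C) X ≫
        (A.X ◁ (λ_ X).hom) ▷ A.X := by
  rw [freeMulAux_eq, freeOneAux]
  have h := A.comul_pairing'
  generalize μ[A.X] ≫ ε[A.X] = p at *
  symm
  calc _ = 𝟙 _ ⊗≫ (Δ[A.X] ▷ A.X ≫ (α_ A.X A.X A.X).hom ≫ A.X ◁ p) ▷ (X ⊗ A.X) ⊗≫ 𝟙 _ := by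
        monoidal
    _ = _ := by rw [h]; monoidal

lemma freeMulAux_right_unit (X : C) :
    (α_ (A.X ⊗ X) A.X A.X).hom ≫ (A.X ⊗ X) ◁ μ[A.X] =
      ((A.X ⊗ X) ⊗ A.X) ◁ A.freeOneAux ≫ A.freeMulAux X (𝟙_ C) ≫
        (A.X ◁ (ρ_ X).hom) ▷ A.X := by
  rw [freeMulAux_eq, freeOneAux]
  have h := A.comul_pairing
  generalize μ[A.X] ≫ ε[A.X] = p at *
  symm
  calc _ = 𝟙 _ ⊗≫ (A.X ⊗ X) ◁ (A.X ◁ Δ[A.X] ≫ (α_ A.X A.X A.X).inv ≫ p ▷ A.X) ⊗≫ 𝟙 _ := by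
        monoidal
    _ = _ := by rw [h]; monoidal

end

section

variable {C : Type*} [Category* C] [MonoidalCategory C] (A : FrobAlg C) [HasCoequalizers C]
  [∀ X : C, PreservesColimitsOfSize.{0, 0} (tensorLeft X)]
  [∀ X : C, PreservesColimitsOfSize.{0, 0} (tensorRight X)]

/-- The structure morphism `Φ(X) ⊗_A Φ(Y) ⟶ Φ(X ⊗ Y)`. -/
noncomputable def freeMul (X Y : C) : A.free.obj X ⊗ A.free.obj Y ⟶ A.free.obj (X ⊗ Y) :=
  Bimod.lift (M := A.free.obj X) (N := A.free.obj Y) (P := A.free.obj (X ⊗ Y))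
    (A.freeMulAux X Y) (A.freeMulAux_balanced X Y) (A.freeMulAux_left X Y) (A.freeMulAux_right X Y)

lemma proj_freeMul (X Y : C) :
    Bimod.proj (A.free.obj X) (A.free.obj Y) ≫ (A.freeMul X Y).hom = A.freeMulAux X Y :=
  Bimod.proj_lift (M := A.free.obj X) (N := A.free.obj Y) (P := A.free.obj (X ⊗ Y)) _ _ _ _

/-- The structure morphism `A ⟶ Φ(𝟙)`. -/
noncomputable def freeOne : 𝟙_ (Bimod A.alg A.alg) ⟶ A.free.obj (𝟙_ C) where
  hom := A.freeOneAux
  left_act_hom := A.freeOneAux_left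
  right_act_hom := A.freeOneAux_right

/-- The (lax) monoidal structure of `Φ`. -/
noncomputable instance instLaxMonoidalFree : A.free.LaxMonoidal where
  ε := A.freeOne
  μ X Y := A.freeMul X Y
  μ_natural_left {X X'} f Y := by
    ext
    rw [← cancel_epi (Bimod.proj _ _), Bimod.comp_hom', Bimod.comp_hom',
      reassoc_of% @Bimod.proj_whiskerRight, A.proj_freeMul, reassoc_of% @A.proj_freeMul]
    exact A.freeMulAux_natural_left f Y
  μ_natural_right {Y Y'} X f := by
    ext
    rw [← cancel_epi (Bimod.proj _ _), Bimod.comp_hom', Bimod.comp_hom',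
      reassoc_of% @Bimod.proj_whiskerLeft, A.proj_freeMul, reassoc_of% @A.proj_freeMul]
    exact A.freeMulAux_natural_right X f
  associativity X Y Z := by
    ext
    rw [← cancel_epi (Bimod.proj _ _), ← cancel_epi (Bimod.proj _ _ ▷ _)]
    simp only [Bimod.comp_hom']
    rw [reassoc_of% @Bimod.proj_associator, reassoc_of% @Bimod.proj_whiskerRight, reassoc_of% @Bimod.proj_whiskerLeft,
      A.proj_freeMul, reassoc_of% @A.proj_freeMul, ← comp_whiskerRight_assoc, A.proj_freeMul]
    refine (A.freeMulAux_assoc X Y Z).trans ?_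
    congr 1
    exact (congrArg (fun t => (A.free.obj X).X ◁ t ≫ A.freeMulAux X (Y ⊗ Z))
      (A.proj_freeMul Y Z)).symm.trans
      (MonoidalCategory.whiskerLeft_comp_assoc _ _ _ _)
  left_unitality X := by
    ext
    rw [← cancel_epi (Bimod.proj _ _)]
    simp only [Bimod.comp_hom']
    rw [Bimod.proj_leftUnitor, reassoc_of% @Bimod.proj_whiskerRight, reassoc_of% @A.proj_freeMul]
    exact A.freeMulAux_left_unit X
  right_unitality X := by
    ext
    rw [← cancel_epi (Bimod.proj _ _)]
    simp only [Bimod.comp_hom']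
    rw [Bimod.proj_rightUnitor, reassoc_of% @Bimod.proj_whiskerLeft, reassoc_of% @A.proj_freeMul]
    exact A.freeMulAux_right_unit X

end

/-- A Frobenius algebra in a `𝕜`-linear monoidal category is special if `m ∘ Δ = id` and `ε ∘ u`
is a nonzero scalar. -/
def IsSpecial (𝕜 : Type*) [Field 𝕜] {C : Type*} [Category* C] [Preadditive C] [Linear 𝕜 C]
    [MonoidalCategory C] (A : FrobAlg C) : Prop :=
  ComonObj.comul ≫ MonObj.mul = 𝟙 A.X ∧
    ∃ φ : 𝕜, φ ≠ 0 ∧ MonObj.one ≫ ComonObj.counit (X := A.X) = φ • 𝟙 (𝟙_ C)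

end FrobAlg

/-! Morita equivalence is recast in a form that lax monoidal functors can transport: a Morita
context, that is, an enriched category with two objects whose endomorphism algebras are the two
given algebras.

From an equivalence to a context (`MoritaEquivalent.exists_enrichedCategory`): let `F` be an
equivalence of module categories from `B`-modules to `B'`-modules, and let `K` be a `B`-module with
`F K ≅ B'`. The modules `B` and `K` have internal homs: `B` from `B` to itself, `K` from `B` to `K`,
`F B` from `K` to `B`, and `B'` from `K` to itself. They form an enriched category in which both
compositions through the other object are regular epimorphisms.

From a context to an equivalence (`IsEnrichedGenerator.moritaEquivalent`): if `(j ⟶ j)` is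
universally the tensor product of `(j ⟶ i)` and `(i ⟶ j)` over `(i ⟶ i)`, for every `j`, then an
enriched presheaf is determined by its value at `i`. So evaluation at `i` is an equivalence of
module categories, and any two such generators have Morita equivalent endomorphism algebras. If
tensoring preserves epimorphisms and these are regular, as in `C`, it is enough that the
compositions through `i` are epimorphisms (`isEnrichedGenerator_of_epi`).

The forward implication transports the context along `Φ`. On underlying objects the new composition
is the pairing `ε m` on the inner factors followed by the old composition, and the pairing is a
split epimorphism because `ε u` is an invertible scalar. Generators among bimodules are detected in
`C` (`Bimod.isEnrichedGenerator`).

For the converse, let `U` be the lax monoidal forgetful functor from bimodules to `C`. Transport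
along `U` shows that `U Φ B` and `U Φ B'` are Morita equivalent in `C`
(`MoritaEquivalent.forgetBoth`). Since `A` is its own dual, `U Φ B`, with underlying object `(A ⊗ B)
⊗ A`, is the internal endomorphism algebra of the `B`-module `A ⊗ B`, and hence Morita equivalent to
`B` (`FrobAlg.moritaEquivalent_freeAlg`). -/

/-! ### Composites and inverses of module functors -/

namespace CategoryTheory.Functor.LeftLinear

open MonoidalLeftAction LaxLeftLinear OplaxLeftLinear

variable {C : Type*} [Category* C] [MonoidalCategory C]
  {D : Type*} [Category* D] [MonoidalLeftAction C D]
  {D' : Type*} [Category* D'] [MonoidalLeftAction C D']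
  {D'' : Type*} [Category* D''] [MonoidalLeftAction C D'']

/-- A lax left linear functor with invertible structure morphisms is left linear. -/
@[reducible]
noncomputable def ofIsIso (F : D ⥤ D') [F.LaxLeftLinear C]
    [∀ (c : C) (d : D), IsIso (μₗ F c d)] : F.LeftLinear C where
  δₗ c d := CategoryTheory.inv (μₗ F c d)
  δₗ_naturality_left f d := by
    rw [IsIso.comp_inv_eq, Category.assoc, IsIso.eq_inv_comp, μₗ_naturality_left]
  δₗ_naturality_right c _ _ f := by
    rw [IsIso.comp_inv_eq, Category.assoc, IsIso.eq_inv_comp, μₗ_naturality_right]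
  δₗ_associativity c c' d := by
    rw [IsIso.inv_comp_eq, ← inv_actionHomRight]
    simp
  δₗ_unitality_inv d := by
    rw [← cancel_mono (μₗ F (𝟙_ C) d)]
    simp
  μₗ_comp_δₗ c d := IsIso.hom_inv_id _
  δₗ_comp_μₗ c d := IsIso.inv_hom_id _

/-- The lax left linear structure of a composition. -/
@[reducible]
def compLax (F : D ⥤ D') (G : D' ⥤ D'') [F.LaxLeftLinear C] [G.LaxLeftLinear C] :
    (F ⋙ G).LaxLeftLinear C where
  μₗ c d := μₗ G c (F.obj d) ≫ G.map (μₗ F c d)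
  μₗ_naturality_left f d := by
    simp [← G.map_comp, -Functor.map_comp]
  μₗ_naturality_right c _ _ f := by
    simp [← G.map_comp, -Functor.map_comp]
  μₗ_associativity c c' d := by
    simp only [comp_obj, Functor.comp_map, Category.assoc, ← G.map_comp, μₗ_associativity]
    simp
  μₗ_unitality d := by
    simp [← G.map_comp, -Functor.map_comp]

/-- A composition of left linear functors is left linear. -/
@[reducible]
noncomputable def comp (F : D ⥤ D') (G : D' ⥤ D'') [F.LeftLinear C] [G.LeftLinear C] :
    (F ⋙ G).LeftLinear C :=
  letI := compLax (C := C) F G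
  haveI (c : C) (d : D) : IsIso (μₗ (F ⋙ G) c d) :=
    inferInstanceAs (IsIso (μₗ G c (F.obj d) ≫ G.map (μₗ F c d)))
  ofIsIso _

section inv

variable (F : D ⥤ D') [F.IsEquivalence] [F.LeftLinear C]

/-- The counit of the equivalence `F`. -/
noncomputable def invCounit (d : D') : F.obj (F.inv.obj d) ≅ d :=
  F.asEquivalence.counitIso.app d

lemma map_inv_map_counit {d d' : D'} (f : d ⟶ d') :
    F.map (F.inv.map f) ≫ (invCounit F d').hom = (invCounit F d).hom ≫ f :=
  F.asEquivalence.counit.naturality f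

/-- The structure morphisms of the inverse of a left linear equivalence. -/
noncomputable def invμ (c : C) (d : D') : c ⊙ₗ F.inv.obj d ⟶ F.inv.obj (c ⊙ₗ d) :=
  F.preimage (δₗ F c (F.inv.obj d) ≫ c ⊴ₗ (invCounit F d).hom ≫ (invCounit F (c ⊙ₗ d)).inv)

lemma map_invμ_counit (c : C) (d : D') :
    F.map (invμ F c d) ≫ (invCounit F (c ⊙ₗ d)).hom =
      δₗ F c (F.inv.obj d) ≫ c ⊴ₗ (invCounit F d).hom := by
  simp [invμ]

/-- The lax left linear structure of the inverse of a left linear equivalence. -/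
@[reducible]
noncomputable def invLax : F.inv.LaxLeftLinear C where
  μₗ c d := invμ F c d
  μₗ_naturality_left f d := by
    apply F.map_injective
    rw [← cancel_mono (invCounit F _).hom]
    rw [F.map_comp, F.map_comp, Category.assoc, Category.assoc, map_invμ_counit,
      map_inv_map_counit, reassoc_of% map_invμ_counit, δₗ_naturality_left_assoc,
      action_exchange]
  μₗ_naturality_right c _ _ f := by
    apply F.map_injective
    rw [← cancel_mono (invCounit F _).hom]
    rw [F.map_comp, F.map_comp, Category.assoc, Category.assoc, map_invμ_counit,
      map_inv_map_counit, reassoc_of% map_invμ_counit, δₗ_naturality_right_assoc,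
      ← actionHomRight_comp, ← actionHomRight_comp, map_inv_map_counit]
  μₗ_associativity c c' d := by
    apply F.map_injective
    rw [← cancel_mono (invCounit F _).hom]
    simp only [F.map_comp, Category.assoc, map_invμ_counit, map_inv_map_counit]
    rw [reassoc_of% map_invμ_counit, δₗ_naturality_right_assoc, ← actionHomRight_comp,
      map_invμ_counit, tensor_actionHomRight]
    simp
  μₗ_unitality d := by
    apply F.map_injective
    rw [← cancel_mono (invCounit F _).hom]
    simp only [F.map_comp, Category.assoc, map_inv_map_counit]
    rw [reassoc_of% map_invμ_counit]
    rw [← actionUnitIso_hom_naturality, δₗ_unitality_hom_assoc]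

/-- The inverse of a left linear equivalence is left linear. -/
@[reducible]
noncomputable def inv : F.inv.LeftLinear C :=
  letI := invLax (C := C) F
  haveI (c : C) (d : D') : IsIso (μₗ F.inv c d) := by
    have h := map_invμ_counit F c d
    have : IsIso (F.map (invμ F c d)) := by
      rw [← IsIso.eq_comp_inv] at h
      rw [h]
      infer_instance
    exact isIso_of_reflects_iso (invμ F c d) F
  ofIsIso _

end inv

end CategoryTheory.Functor.LeftLinear

lemma MoritaEquivalent.trans {C : Type*} [Category* C] [MonoidalCategory C] {A B B' : Mon C}
    (h : MoritaEquivalent A B) (h' : MoritaEquivalent B B') : MoritaEquivalent A B' := by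
  obtain ⟨F, _, ⟨_⟩⟩ := h
  obtain ⟨G, _, ⟨_⟩⟩ := h'
  exact ⟨F ⋙ G, inferInstance, ⟨Functor.LeftLinear.comp F G⟩⟩

/-! ### Modules over an enriched category -/

section

variable (D : Type*) [Category* D] [MonoidalCategory D] {ι : Type*} [EnrichedCategory D ι]

lemma eId_whiskerRight_eComp (i j : ι) :
    eId D i ▷ (i ⟶[D] j) ≫ eComp D i i j = (λ_ (i ⟶[D] j)).hom := by
  rw [← cancel_epi (λ_ (i ⟶[D] j)).inv, e_id_comp, Iso.inv_hom_id]

lemma whiskerLeft_eId_eComp (i j : ι) :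
    (i ⟶[D] j) ◁ eId D j ≫ eComp D i j j = (ρ_ (i ⟶[D] j)).hom := by
  rw [← cancel_epi (ρ_ (i ⟶[D] j)).inv, e_comp_id, Iso.inv_hom_id]

/-- The algebra of endomorphisms of an object of an enriched category. -/
abbrev enrichedEnd (i : ι) : Mon D where
  X := i ⟶[D] i
  mon :=
    { one := eId D i
      mul := eComp D i i i
      one_mul := eId_whiskerRight_eComp D i i
      mul_one := whiskerLeft_eId_eComp D i i
      mul_assoc := (e_assoc' D i i i i).symm }

/-- A module over the enriched category `ι`, i.e. an enriched presheaf. -/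
structure EnrichedMod (ι : Type*) [EnrichedCategory D ι] where
  /-- The underlying objects. -/
  X : ι → D
  /-- The actions of the morphism objects. -/
  act (i j : ι) : X i ⊗ (i ⟶[D] j) ⟶ X j
  act_id (i : ι) : X i ◁ eId D i ≫ act i i = (ρ_ (X i)).hom
  act_act (i j k : ι) : act i j ▷ (j ⟶[D] k) ≫ act j k =
    (α_ (X i) (i ⟶[D] j) (j ⟶[D] k)).hom ≫ X i ◁ eComp D i j k ≫ act i k

end

namespace EnrichedMod

variable {D : Type*} [Category* D] [MonoidalCategory D] {ι : Type*} [EnrichedCategory D ι]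

/-- A morphism of modules over an enriched category. -/
@[ext]
structure Hom (M N : EnrichedMod D ι) where
  /-- The underlying morphisms. -/
  hom (i : ι) : M.X i ⟶ N.X i
  act_hom (i j : ι) : M.act i j ≫ hom j = hom i ▷ (i ⟶[D] j) ≫ N.act i j

instance : Category (EnrichedMod D ι) where
  Hom M N := Hom M N
  id M := ⟨fun i => 𝟙 (M.X i), fun i j => by simp⟩
  comp f g := ⟨fun i => f.hom i ≫ g.hom i, fun i j => by
    rw [comp_whiskerRight, Category.assoc, ← g.act_hom, ← Category.assoc, f.act_hom,
      Category.assoc]⟩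

@[ext]
lemma hom_ext {M N : EnrichedMod D ι} (f g : M ⟶ N) (h : ∀ i, Hom.hom f i = Hom.hom g i) : f = g :=
  Hom.ext (funext h)

/-- An isomorphism of modules from isomorphisms in `D` that are compatible with the actions. -/
@[simps]
def mkIso {M N : EnrichedMod D ι} (e : ∀ i, M.X i ≅ N.X i)
    (h : ∀ i j, M.act i j ≫ (e j).hom = (e i).hom ▷ (i ⟶[D] j) ≫ N.act i j) : M ≅ N where
  hom := ⟨fun i => (e i).hom, h⟩
  inv := ⟨fun i => (e i).inv, fun i j => by
    rw [← cancel_mono (e j).hom, Category.assoc, Category.assoc, h, ← comp_whiskerRight_assoc]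
    simp⟩
  hom_inv_id := by ext i; exact (e i).hom_inv_id
  inv_hom_id := by ext i; exact (e i).inv_hom_id

/-- The module `X ⊗ M`. -/
@[simps]
def tensorObj (X : D) (M : EnrichedMod D ι) : EnrichedMod D ι where
  X i := X ⊗ M.X i
  act i j := (α_ X (M.X i) (i ⟶[D] j)).hom ≫ X ◁ M.act i j
  act_id i := by
    rw [associator_naturality_right_assoc, ← whiskerLeft_comp, M.act_id]
    monoidal
  act_act i j k := by
    simp only [comp_whiskerRight, whisker_assoc, Category.assoc, Iso.inv_hom_id_assoc,
      ← whiskerLeft_comp, M.act_act]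
    simp

/-- The modules over a `D`-enriched category form a left `D`-module category. -/
instance instMonoidalLeftAction : MonoidalLeftAction D (EnrichedMod D ι) where
  actionObj X M := tensorObj X M
  actionHomLeft {X Y} f M := ⟨fun i => f ▷ M.X i, fun i j => by
    change ((α_ X (M.X i) (i ⟶[D] j)).hom ≫ X ◁ M.act i j) ≫ f ▷ M.X j =
      f ▷ M.X i ▷ (i ⟶[D] j) ≫ (α_ Y (M.X i) (i ⟶[D] j)).hom ≫ Y ◁ M.act i j
    rw [associator_naturality_left_assoc, ← whisker_exchange, Category.assoc]⟩
  actionHomRight X {M N} f := ⟨fun i => X ◁ f.hom i, fun i j => by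
    change ((α_ X (M.X i) (i ⟶[D] j)).hom ≫ X ◁ M.act i j) ≫ X ◁ f.hom j =
      (X ◁ f.hom i) ▷ (i ⟶[D] j) ≫ (α_ X (N.X i) (i ⟶[D] j)).hom ≫ X ◁ N.act i j
    rw [associator_naturality_middle_assoc, Category.assoc, ← MonoidalCategory.whiskerLeft_comp,
      ← MonoidalCategory.whiskerLeft_comp, f.act_hom]⟩
  actionHom {X Y M N} f g := ⟨fun i => f ⊗ₘ g.hom i, fun i j => by
    change ((α_ X (M.X i) (i ⟶[D] j)).hom ≫ X ◁ M.act i j) ≫ (f ⊗ₘ g.hom j) =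
      (f ⊗ₘ g.hom i) ▷ (i ⟶[D] j) ≫ (α_ Y (N.X i) (i ⟶[D] j)).hom ≫ Y ◁ N.act i j
    rw [MonoidalCategory.tensorHom_def f (g.hom i), MonoidalCategory.tensorHom_def f (g.hom j),
      comp_whiskerRight, Category.assoc, Category.assoc,
      associator_naturality_middle_assoc, associator_naturality_left_assoc,
      whisker_exchange_assoc, ← MonoidalCategory.whiskerLeft_comp,
      ← MonoidalCategory.whiskerLeft_comp, g.act_hom]⟩
  actionAssocIso X Y M := mkIso (fun i => α_ X Y (M.X i)) (fun i j => by
    change ((α_ (X ⊗ Y) (M.X i) (i ⟶[D] j)).hom ≫ (X ⊗ Y) ◁ M.act i j) ≫ (α_ X Y (M.X j)).hom =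
      (α_ X Y (M.X i)).hom ▷ (i ⟶[D] j) ≫ (α_ X (Y ⊗ M.X i) (i ⟶[D] j)).hom ≫
        X ◁ ((α_ Y (M.X i) (i ⟶[D] j)).hom ≫ Y ◁ M.act i j)
    simp)
  actionUnitIso M := mkIso (fun i => λ_ (M.X i)) (fun i j => by
    change ((α_ (𝟙_ D) (M.X i) (i ⟶[D] j)).hom ≫ 𝟙_ D ◁ M.act i j) ≫ (λ_ (M.X j)).hom =
      (λ_ (M.X i)).hom ▷ (i ⟶[D] j) ≫ M.act i j
    simp)
  actionHom_def f g := by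
    ext i; exact MonoidalCategory.tensorHom_def f (g.hom i)
  actionHomRight_id X M := by
    ext i; exact MonoidalCategory.whiskerLeft_id X (M.X i)
  id_actionHomLeft X M := by
    ext i; exact MonoidalCategory.id_whiskerRight X (M.X i)
  actionHom_comp f₁ f₂ g₁ g₂ := by
    ext i; exact (tensorHom_comp_tensorHom f₁ (g₁.hom i) f₂ (g₂.hom i)).symm
  actionAssocIso_hom_naturality f g h := by
    ext i; exact MonoidalCategory.associator_naturality f g (h.hom i)
  actionUnitIso_hom_naturality f := by
    ext i; exact (MonoidalCategory.leftUnitor_naturality (f.hom i)).symm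
  whiskerLeft_actionHomLeft X _ _ f M := by
    ext i; exact whisker_assoc X f (M.X i)
  whiskerRight_actionHomLeft {X X'} Y f M := by
    ext i
    change (f ▷ Y) ▷ M.X i = (α_ X Y (M.X i)).hom ≫ f ▷ (Y ⊗ M.X i) ≫ (α_ X' Y (M.X i)).inv
    simp
  associator_actionHom X Y Z M := by
    ext i; exact MonoidalCategory.pentagon X Y Z (M.X i)
  leftUnitor_actionHom X M := by
    ext i
    change (λ_ X).hom ▷ M.X i = (α_ (𝟙_ D) X (M.X i)).hom ≫ (λ_ (X ⊗ M.X i)).hom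
    simp
  rightUnitor_actionHom X M := by
    ext i
    change (ρ_ X).hom ▷ M.X i = (α_ X (𝟙_ D) (M.X i)).hom ≫ X ◁ (λ_ (M.X i)).hom
    simp

variable (D) in
/-- The value of a module at an object `i`, as a module over the endomorphisms of `i`. -/
@[simps]
def eval (i : ι) : EnrichedMod D ι ⥤ RightMod (enrichedEnd D i) where
  obj M :=
    { X := M.X i
      act := M.act i i
      act_one := M.act_id i
      act_act := M.act_act i i i }
  map f := ⟨f.hom i, f.act_hom i i⟩

open MonoidalLeftAction in
instance (i : ι) : (eval D i).LeftLinear D where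
  μₗ X M := 𝟙 _
  δₗ X M := 𝟙 _
  μₗ_naturality_left f M := (Category.comp_id _).trans (Category.id_comp _).symm
  μₗ_naturality_right X M N f := (Category.comp_id _).trans (Category.id_comp _).symm
  δₗ_naturality_left f M := (Category.comp_id _).trans (Category.id_comp _).symm
  δₗ_naturality_right X M N f := (Category.comp_id _).trans (Category.id_comp _).symm
  μₗ_associativity X Y M := by
    ext
    change 𝟙 ((X ⊗ Y) ⊗ M.X i) ≫ (α_ X Y (M.X i)).hom =
      (α_ X Y (M.X i)).hom ≫ X ◁ 𝟙 (Y ⊗ M.X i) ≫ 𝟙 (X ⊗ Y ⊗ M.X i)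
    simp
  δₗ_associativity X Y M := by
    ext
    change 𝟙 ((X ⊗ Y) ⊗ M.X i) ≫ (α_ X Y (M.X i)).hom =
      (α_ X Y (M.X i)).hom ≫ 𝟙 (X ⊗ Y ⊗ M.X i) ≫ X ◁ 𝟙 (Y ⊗ M.X i)
    simp
  μₗ_unitality M := (Category.id_comp _).symm
  δₗ_unitality_inv M := (Category.comp_id _).symm
  μₗ_comp_δₗ X M := Category.comp_id _
  δₗ_comp_μₗ X M := Category.comp_id _

end EnrichedMod

/-! ### Generators of an enriched category and Morita equivalence -/

section

variable (D : Type*) [Category* D] [MonoidalCategory D]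

/-- An object `i` of an enriched category is a generator if the composition exhibits each object of
endomorphisms `(j ⟶ j)` as the tensor product of `(j ⟶ i)` and `(i ⟶ j)` over `(i ⟶ i)`, universally
with respect to tensoring. -/
structure IsEnrichedGenerator {ι : Type*} [EnrichedCategory D ι] (i : ι) : Prop where
  epi_comp_whiskerRight (j : ι) (M X : D) : Epi ((M ◁ eComp D j i j) ▷ X)
  exists_desc (j : ι) (M Z : D) (t : M ⊗ (j ⟶[D] i) ⊗ (i ⟶[D] j) ⟶ Z)
    (h : M ◁ (eComp D j i i ▷ (i ⟶[D] j)) ≫ t =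
      M ◁ ((α_ (j ⟶[D] i) (i ⟶[D] i) (i ⟶[D] j)).hom ≫ (j ⟶[D] i) ◁ eComp D i i j) ≫ t) :
    ∃ k : M ⊗ (j ⟶[D] j) ⟶ Z, M ◁ eComp D j i j ≫ k = t

/-- A monoidal category has right stable coequalizers if every parallel pair has a coequalizer that
is preserved by tensoring on the right. -/
class HasRightStableCoequalizers : Prop where
  exists_coequalizer {M N : D} (f g : M ⟶ N) : ∃ (Q : D) (q : N ⟶ Q), f ≫ q = g ≫ q ∧
    (∀ X, Epi (q ▷ X)) ∧
      ∀ (X Z : D) (h : N ⊗ X ⟶ Z), f ▷ X ≫ h = g ▷ X ≫ h → ∃ k, q ▷ X ≫ k = h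

end

lemma epi_of_epi_whiskerRight_tensorUnit {D : Type*} [Category* D] [MonoidalCategory D] {X Y : D}
    (f : X ⟶ Y) [Epi (f ▷ 𝟙_ D)] : Epi f := by
  have e : (ρ_ X).hom ≫ f = f ▷ 𝟙_ D ≫ (ρ_ Y).hom := (rightUnitor_naturality f).symm
  have : Epi ((ρ_ X).hom ≫ f) := by rw [e]; infer_instance
  exact epi_of_epi (ρ_ X).hom f

lemma epi_of_epi_tensorUnit_whiskerLeft {D : Type*} [Category* D] [MonoidalCategory D] {X Y : D}
    (f : X ⟶ Y) [Epi (𝟙_ D ◁ f)] : Epi f := by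
  have e : (λ_ X).hom ≫ f = 𝟙_ D ◁ f ≫ (λ_ Y).hom := (leftUnitor_naturality f).symm
  have : Epi ((λ_ X).hom ≫ f) := by rw [e]; infer_instance
  exact epi_of_epi (λ_ X).hom f

lemma exists_desc_of_whiskerRight_tensorUnit {D : Type*} [Category* D] [MonoidalCategory D]
    {M N Q : D} {f g : M ⟶ N} {q : N ⟶ Q}
    (h : ∀ (X Z : D) (t : N ⊗ X ⟶ Z), f ▷ X ≫ t = g ▷ X ≫ t → ∃ k, q ▷ X ≫ k = t)
    {Z : D} (t : N ⟶ Z) (e : f ≫ t = g ≫ t) : ∃ k, q ≫ k = t := by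
  obtain ⟨k, hk⟩ := h (𝟙_ D) Z ((ρ_ _).hom ≫ t) (by
    rw [rightUnitor_naturality_assoc, rightUnitor_naturality_assoc, e])
  exact ⟨(ρ_ _).inv ≫ k, by rw [rightUnitor_inv_naturality_assoc, hk, Iso.inv_hom_id_assoc]⟩

lemma IsEnrichedGenerator.epi_comp {D : Type*} [Category* D] [MonoidalCategory D] {ι : Type*}
    [EnrichedCategory D ι] {i : ι} (h : IsEnrichedGenerator D i) (j : ι) (M : D) :
    Epi (M ◁ eComp D j i j) := by
  have := h.epi_comp_whiskerRight j M (𝟙_ D)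
  exact epi_of_epi_whiskerRight_tensorUnit _

namespace EnrichedMod

variable {D : Type*} [Category* D] [MonoidalCategory D] {ι : Type*} [EnrichedCategory D ι] {i : ι}

/-- The action of `(j ⟶ j)` on `M j` is split by the identity of `j`. Precomposed with the
composition through `i`, which is epi, it factors through the action `M i ⊗ (i ⟶ j) ⟶ M j` by
associativity. -/
lemma epi_act_whiskerRight (h : IsEnrichedGenerator D i) (M : EnrichedMod D ι) (j : ι) (X : D) :
    Epi (M.act i j ▷ X) := by
  have := h.epi_comp_whiskerRight j (M.X j) X
  have : IsSplitEpi (M.act j j) :=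
    ⟨⟨(ρ_ _).inv ≫ M.X j ◁ eId D j, by rw [Category.assoc, M.act_id, Iso.inv_hom_id]⟩⟩
  have : IsSplitEpi (M.act j j ▷ X) := inferInstanceAs (IsSplitEpi ((tensorRight X).map _))
  have e : ((α_ _ _ _).inv ≫ M.act j i ▷ (i ⟶[D] j)) ≫ M.act i j =
      M.X j ◁ eComp D j i j ≫ M.act j j := by
    rw [Category.assoc, M.act_act, Iso.inv_hom_id_assoc]
  have : Epi (((α_ _ _ _).inv ≫ M.act j i ▷ (i ⟶[D] j)) ▷ X ≫ M.act i j ▷ X) := by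
    rw [← comp_whiskerRight, e, comp_whiskerRight]
    infer_instance
  exact epi_of_epi (((α_ _ _ _).inv ≫ M.act j i ▷ (i ⟶[D] j)) ▷ X) _

lemma epi_act (h : IsEnrichedGenerator D i) (M : EnrichedMod D ι) (j : ι) : Epi (M.act i j) :=
  have := epi_act_whiskerRight h M j (𝟙_ D)
  epi_of_epi_whiskerRight_tensorUnit _

/-- Together with `epi_act`, this identifies `M j` with the tensor product of `M i` and `(i ⟶ j)`
over `(i ⟶ i)`. The universal property for `(j ⟶ j)`, tensored with `M j`, is restricted to the
identity of `j`. -/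
lemma exists_act_desc (h : IsEnrichedGenerator D i) (M : EnrichedMod D ι) (j : ι) {Z : D}
    (t : M.X i ⊗ (i ⟶[D] j) ⟶ Z)
    (ht : M.act i i ▷ (i ⟶[D] j) ≫ t = (α_ _ _ _).hom ≫ M.X i ◁ eComp D i i j ≫ t) :
    ∃ k, M.act i j ≫ k = t := by
  obtain ⟨k, hk⟩ := h.exists_desc j (M.X j) Z ((α_ _ _ _).inv ≫ M.act j i ▷ _ ≫ t) (by
    symm
    calc _ = 𝟙 _ ⊗≫ ((M.X j ⊗ (j ⟶[D] i)) ◁ eComp D i i j ≫ M.act j i ▷ (i ⟶[D] j)) ⊗≫ t := by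
          monoidal
      _ = 𝟙 _ ⊗≫ M.act j i ▷ ((i ⟶[D] i) ⊗ (i ⟶[D] j)) ≫
            (α_ _ _ _).inv ≫ ((α_ _ _ _).hom ≫ M.X i ◁ eComp D i i j ≫ t) := by
          rw [whisker_exchange]; monoidal
      _ = 𝟙 _ ⊗≫ (M.act j i ▷ (i ⟶[D] i) ≫ M.act i i) ▷ (i ⟶[D] j) ≫ t := by
          rw [← ht]; monoidal
      _ = _ := by rw [M.act_act]; monoidal)
  refine ⟨(ρ_ _).inv ≫ M.X j ◁ eId D j ≫ k, ?_⟩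
  -- On elements: `k (x · f, g) = t (x, f ≫ g)`. It suffices to test `g` that are composites through
  -- `i`, where balancedness of `t` applies; the case `g = 𝟙` is the claim.
  have key : M.act i j ▷ (j ⟶[D] j) ≫ k =
      (α_ _ _ _).hom ≫ M.X i ◁ eComp D i j j ≫ t := by
    have := h.epi_comp j (M.X i ⊗ (i ⟶[D] j))
    rw [← cancel_epi ((M.X i ⊗ (i ⟶[D] j)) ◁ eComp D j i j), ← Category.assoc, whisker_exchange,
      Category.assoc, hk]
    calc _ = 𝟙 _ ⊗≫ (M.act i j ▷ (j ⟶[D] i) ≫ M.act j i) ▷ (i ⟶[D] j) ≫ t := by monoidal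
      _ = 𝟙 _ ⊗≫ (M.X i ◁ eComp D i j i) ▷ (i ⟶[D] j) ≫ M.act i i ▷ (i ⟶[D] j) ≫ t := by
          rw [M.act_act]; monoidal
      _ = 𝟙 _ ⊗≫ M.X i ◁ (eComp D i j i ▷ (i ⟶[D] j) ≫ eComp D i i j) ≫ t := by
          rw [ht]; monoidal
      _ = 𝟙 _ ⊗≫ M.X i ◁ ((i ⟶[D] j) ◁ eComp D j i j ≫ eComp D i j j) ≫ t := by
          rw [← e_assoc]; monoidal
      _ = _ := by monoidal
  calc _ = (ρ_ _).inv ≫ ((M.X i ⊗ (i ⟶[D] j)) ◁ eId D j ≫ M.act i j ▷ (j ⟶[D] j)) ≫ k := by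
        rw [whisker_exchange]; monoidal
    _ = 𝟙 _ ⊗≫ M.X i ◁ ((i ⟶[D] j) ◁ eId D j ≫ eComp D i j j) ≫ t := by
        rw [Category.assoc, key]; monoidal
    _ = t := by rw [whiskerLeft_eId_eComp]; monoidal

lemma faithful_eval (h : IsEnrichedGenerator D i) : (eval D i).Faithful where
  map_injective {M N} f g e := by
    ext j
    have := epi_act h M j
    rw [← cancel_epi (M.act i j), f.act_hom, g.act_hom]
    have e' : f.hom i = g.hom i := congrArg RightMod.Hom.hom e
    rw [e']

/-- A map `g` at `i` is extended to `j` by descending `x ⊗ f ↦ g x · f` along the action `M i ⊗ (i ⟶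
j) ⟶ M j`. -/
lemma full_eval (h : IsEnrichedGenerator D i) : (eval D i).Full where
  map_surjective {M N} f := by
    obtain ⟨g, hg⟩ : ∃ g : M.X i ⟶ N.X i, f.hom = g := ⟨_, rfl⟩
    have hf : M.act i i ≫ g = g ▷ (i ⟶[D] i) ≫ N.act i i := by
      rw [← hg]; exact f.act_hom
    have key (j : ι) := exists_act_desc h M j (g ▷ (i ⟶[D] j) ≫ N.act i j) (by
      rw [← comp_whiskerRight_assoc, hf, comp_whiskerRight_assoc, N.act_act,
        associator_naturality_left_assoc, ← whisker_exchange_assoc])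
    choose φ hφ using key
    refine ⟨⟨φ, fun j k => ?_⟩, ?_⟩
    · have := epi_act_whiskerRight h M j (j ⟶[D] k)
      rw [← cancel_epi (M.act i j ▷ (j ⟶[D] k)), ← Category.assoc, M.act_act, Category.assoc,
        Category.assoc, hφ, ← comp_whiskerRight_assoc, hφ, comp_whiskerRight_assoc, N.act_act,
        associator_naturality_left_assoc, ← whisker_exchange_assoc]
    · ext
      have := epi_act h M i
      refine Eq.trans ?_ hg.symm
      change φ i = g
      rw [← cancel_epi (M.act i i), hφ, hf]

/-- Every module over the endomorphisms of `i` extends to a module over the enriched category. -/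
lemma essSurj_eval [HasRightStableCoequalizers D] (i : ι) : (eval D i).EssSurj where
  mem_essImage M := by
    obtain ⟨M, a, a_one, a_act⟩ := M
    change M ⊗ (i ⟶[D] i) ⟶ M at a
    change M ◁ eId D i ≫ a = (ρ_ M).hom at a_one
    change a ▷ (i ⟶[D] i) ≫ a = (α_ M _ _).hom ≫ M ◁ eComp D i i i ≫ a at a_act
    -- The extension at `j` is the tensor product of `M` and `(i ⟶ j)` over `(i ⟶ i)`.
    choose Q q w hepi hdesc using fun j =>
      HasRightStableCoequalizers.exists_coequalizer (a ▷ (i ⟶[D] j))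
        ((α_ M _ _).hom ≫ M ◁ eComp D i i j)
    have epi_q (j : ι) : Epi (q j) :=
      have := hepi j (𝟙_ D)
      epi_of_epi_whiskerRight_tensorUnit _
    have epi_q₂ (j : ι) (X Y : D) : Epi (q j ▷ X ▷ Y) := by
      have := hepi j (X ⊗ Y)
      have e : q j ▷ X ▷ Y = (α_ _ _ _).hom ≫ q j ▷ (X ⊗ Y) ≫ (α_ _ _ _).inv := by simp
      rw [e]
      infer_instance
    have hact (j k : ι) := hdesc j (j ⟶[D] k) _ ((α_ M _ _).hom ≫ M ◁ eComp D i j k ≫ q k) (by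
      calc _ = 𝟙 _ ⊗≫ (a ▷ ((i ⟶[D] j) ⊗ (j ⟶[D] k)) ≫ M ◁ eComp D i j k) ≫ q k := by monoidal
        _ = 𝟙 _ ⊗≫ (M ⊗ (i ⟶[D] i)) ◁ eComp D i j k ≫ a ▷ (i ⟶[D] k) ≫ q k := by
            rw [← whisker_exchange]; monoidal
        _ = 𝟙 _ ⊗≫ M ◁ ((i ⟶[D] i) ◁ eComp D i j k ≫ eComp D i i k) ≫ q k := by
            rw [w]; monoidal
        _ = _ := by rw [← e_assoc]; monoidal)
    choose b hb using hact
    -- The action `a` coequalizes the pair at `i` by associativity; the induced `s` is inverse to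
    -- inserting the identity of `i`.
    obtain ⟨s, hs⟩ := exists_desc_of_whiskerRight_tensorUnit (hdesc i) a (by
      rw [a_act, Category.assoc])
    let N : EnrichedMod D ι :=
      { X := Q
        act := b
        act_id j := by
          have := hepi j (𝟙_ D)
          rw [← cancel_epi (q j ▷ 𝟙_ D), ← whisker_exchange_assoc, hb]
          calc _ = 𝟙 _ ⊗≫ M ◁ ((i ⟶[D] j) ◁ eId D j ≫ eComp D i j j) ≫ q j := by monoidal
            _ = _ := by rw [whiskerLeft_eId_eComp]; monoidal
        act_act j k l := by
          rw [← cancel_epi (q j ▷ (j ⟶[D] k) ▷ (k ⟶[D] l)), ← comp_whiskerRight_assoc, hb]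
          rw [associator_naturality_left_assoc, ← whisker_exchange_assoc, hb]
          calc _ = 𝟙 _ ⊗≫ (M ◁ eComp D i j k) ▷ (k ⟶[D] l) ≫ q k ▷ (k ⟶[D] l) ≫ b k l := by
                monoidal
            _ = 𝟙 _ ⊗≫ M ◁ (eComp D i j k ▷ (k ⟶[D] l) ≫ eComp D i k l) ≫ q l := by
                rw [hb]; monoidal
            _ = _ := by rw [← e_assoc']; monoidal }
    refine ⟨N, ⟨RightMod.mkIso ⟨s, (ρ_ M).inv ≫ M ◁ eId D i ≫ q i, ?_, ?_⟩ ?_⟩⟩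
    · change s ≫ (ρ_ M).inv ≫ M ◁ eId D i ≫ q i = 𝟙 (Q i)
      rw [← cancel_epi (q i), reassoc_of% hs]
      calc _ = 𝟙 _ ⊗≫ (a ▷ 𝟙_ D ≫ M ◁ eId D i) ≫ q i := by monoidal
        _ = 𝟙 _ ⊗≫ (M ⊗ (i ⟶[D] i)) ◁ eId D i ≫ a ▷ (i ⟶[D] i) ≫ q i := by
            rw [← whisker_exchange]; monoidal
        _ = 𝟙 _ ⊗≫ M ◁ ((i ⟶[D] i) ◁ eId D i ≫ eComp D i i i) ≫ q i := by
            rw [w]; monoidal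
        _ = _ := by rw [whiskerLeft_eId_eComp]; monoidal
    · change ((ρ_ M).inv ≫ M ◁ eId D i ≫ q i) ≫ s = 𝟙 M
      rw [Category.assoc, Category.assoc, hs, a_one, Iso.inv_hom_id]
    · have := hepi i (i ⟶[D] i)
      change b i i ≫ s = s ▷ (i ⟶[D] i) ≫ a
      rw [← cancel_epi (q i ▷ (i ⟶[D] i)), ← Category.assoc, hb, Category.assoc, Category.assoc, hs,
        ← comp_whiskerRight_assoc, hs, a_act]

lemma isEquivalence_eval [HasRightStableCoequalizers D] (h : IsEnrichedGenerator D i) :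
    (eval D i).IsEquivalence :=
  { faithful := faithful_eval h
    full := full_eval h
    essSurj := essSurj_eval i }

end EnrichedMod

/-- The endomorphism algebras of two generators are Morita equivalent. -/
theorem IsEnrichedGenerator.moritaEquivalent {D : Type*} [Category* D] [MonoidalCategory D]
    [HasRightStableCoequalizers D] {ι : Type*} [EnrichedCategory D ι] {i j : ι}
    (hi : IsEnrichedGenerator D i) (hj : IsEnrichedGenerator D j) :
    MoritaEquivalent (enrichedEnd D i) (enrichedEnd D j) := by
  have := EnrichedMod.isEquivalence_eval hi
  have := EnrichedMod.isEquivalence_eval hj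
  let _ := Functor.LeftLinear.inv (C := D) (EnrichedMod.eval D i)
  exact ⟨(EnrichedMod.eval D i).inv ⋙ EnrichedMod.eval D j, inferInstance,
    ⟨Functor.LeftLinear.comp _ _⟩⟩

/-! ### Regular epimorphisms and equivalences -/

namespace CategoryTheory

variable {C : Type*} [Category* C] {D : Type*} [Category* D]

lemma IsRegularEpi.of_exists_desc {X Y W : C} (f : X ⟶ Y) [Epi f] (u v : W ⟶ X)
    (w : u ≫ f = v ≫ f) (h : ∀ (Z : C) (t : X ⟶ Z), u ≫ t = v ≫ t → ∃ k, f ≫ k = t) :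
    IsRegularEpi f := by
  choose k hk using h
  exact ⟨⟨⟨_, u, v, w, Cofork.IsColimit.mk _ (fun s => k _ s.π s.condition)
    (fun s => hk _ _ _) (fun s m hm => by
      rw [← cancel_epi f]
      exact hm.trans (hk _ _ _).symm)⟩⟩⟩

lemma IsRegularEpi.map_of_isEquivalence (F : C ⥤ D) [F.IsEquivalence] {X Y : C} (f : X ⟶ Y)
    [IsRegularEpi f] : IsRegularEpi (F.map f) :=
  ⟨⟨{ W := F.obj (IsRegularEpi.W f)
      left := F.map (IsRegularEpi.left f)
      right := F.map (IsRegularEpi.right f)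
      w := by rw [← F.map_comp, IsRegularEpi.w, F.map_comp]
      isColimit := isColimitCoforkMapOfIsColimit F _ (IsRegularEpi.isColimit f) }⟩⟩

lemma IsRegularEpi.of_map_of_isEquivalence (F : C ⥤ D) [F.IsEquivalence] {X Y : C} (f : X ⟶ Y)
    [IsRegularEpi (F.map f)] : IsRegularEpi f :=
  have := IsRegularEpi.map_of_isEquivalence F.inv (F.map f)
  ⟨⟨RegularEpi.ofArrowIso (Arrow.isoMk (F.asEquivalence.unitIso.app X).symm
    (F.asEquivalence.unitIso.app Y).symm (F.asEquivalence.unitIso.inv.naturality f).symm)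
    (IsRegularEpi.getStruct (F.inv.map (F.map f)))⟩⟩

lemma IsRegularEpi.iso_comp {X Y Z : C} (f : X ⟶ Y) [IsIso f] (g : Y ⟶ Z) [IsRegularEpi g] :
    IsRegularEpi (f ≫ g) :=
  MorphismProperty.RespectsIso.precomp (MorphismProperty.regularEpi C) f g ‹_›

lemma IsRegularEpi.comp_iso {X Y Z : C} (f : X ⟶ Y) [IsRegularEpi f] (g : Y ⟶ Z) [IsIso g] :
    IsRegularEpi (f ≫ g) :=
  MorphismProperty.RespectsIso.postcomp (MorphismProperty.regularEpi C) g f ‹_›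

end CategoryTheory

/-! ### Internal homs -/

open MonoidalLeftAction in
/-- Internal homs between the objects of a family in a left `D`-module category. -/
structure InternalHoms (D : Type*) [Category* D] [MonoidalCategory D] {Mo : Type*} [Category* Mo]
    [MonoidalLeftAction D Mo] {ι : Type*} (M : ι → Mo) where
  /-- The internal hom from `M j` to `M i`. -/
  H (i j : ι) : D
  /-- The evaluation. -/
  ev (i j : ι) : H i j ⊙ₗ M j ⟶ M i
  bijective (i j : ι) (X : D) : Function.Bijective fun g : X ⟶ H i j => g ⊵ₗ M j ≫ ev i j

namespace InternalHoms

open MonoidalLeftAction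

variable {D : Type*} [Category* D] [MonoidalCategory D] {Mo : Type*} [Category* Mo]
  [MonoidalLeftAction D Mo] {ι : Type*} {M : ι → Mo} (S : InternalHoms D M)

lemma hom_ext {i j : ι} {X : D} {g g' : X ⟶ S.H i j}
    (h : g ⊵ₗ M j ≫ S.ev i j = g' ⊵ₗ M j ≫ S.ev i j) : g = g' :=
  (S.bijective i j X).1 h

/-- The morphism into an internal hom that corresponds to a morphism in the module category. -/
noncomputable def curry {i j : ι} {X : D} (f : X ⊙ₗ M j ⟶ M i) : X ⟶ S.H i j :=
  ((S.bijective i j X).2 f).choose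

lemma curry_ev {i j : ι} {X : D} (f : X ⊙ₗ M j ⟶ M i) : S.curry f ⊵ₗ M j ≫ S.ev i j = f :=
  ((S.bijective i j X).2 f).choose_spec

/-- The composition of internal homs. -/
noncomputable def comp (i j k : ι) : S.H i j ⊗ S.H j k ⟶ S.H i k :=
  S.curry ((αₗ _ _ _).hom ≫ S.H i j ⊴ₗ S.ev j k ≫ S.ev i j)

lemma comp_ev (i j k : ι) :
    S.comp i j k ⊵ₗ M k ≫ S.ev i k = (αₗ _ _ _).hom ≫ S.H i j ⊴ₗ S.ev j k ≫ S.ev i j :=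
  S.curry_ev _

/-- The enriched category of the objects of a family with internal homs. Composition is in
diagrammatic order, so that the morphisms `i ⟶ j` are the internal hom from `M j` to `M i`. -/
@[reducible]
noncomputable def enrichedCategory : EnrichedCategory D ι where
  Hom i j := S.H i j
  id i := S.curry (λₗ (M i)).hom
  comp i j k := S.comp i j k
  id_comp i j := by
    rw [← cancel_epi (λ_ _).hom, Iso.hom_inv_id_assoc, Category.comp_id]
    apply S.hom_ext
    rw [comp_actionHomLeft, Category.assoc, S.comp_ev, whiskerRight_actionHomLeft]
    simp only [Category.assoc, Iso.inv_hom_id_assoc]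
    rw [← action_exchange_assoc, S.curry_ev]
    simp
  comp_id i j := by
    rw [← cancel_epi (ρ_ _).hom, Iso.hom_inv_id_assoc, Category.comp_id]
    apply S.hom_ext
    rw [comp_actionHomLeft, Category.assoc, S.comp_ev, whiskerLeft_actionHomLeft]
    simp only [Category.assoc, Iso.inv_hom_id_assoc]
    rw [← actionHomRight_comp_assoc, S.curry_ev]
    simp
  assoc i j k l := by
    rw [Iso.inv_comp_eq]
    apply S.hom_ext
    simp only [comp_actionHomLeft, Category.assoc, S.comp_ev]
    rw [whiskerRight_actionHomLeft, whiskerLeft_actionHomLeft]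
    simp only [Category.assoc, Iso.inv_hom_id_assoc]
    rw [← action_exchange_assoc, S.comp_ev, ← actionHomRight_comp_assoc, S.comp_ev]
    simp

lemma comp_eq {i j k : ι} (c : S.H i j ⊗ S.H j k ⟶ S.H i k)
    (h : c ⊵ₗ M k ≫ S.ev i k = (αₗ _ _ _).hom ≫ S.H i j ⊴ₗ S.ev j k ≫ S.ev i j) :
    S.comp i j k = c :=
  S.hom_ext ((S.comp_ev i j k).trans h.symm)

/-- Only the multiplications need comparing, because a multiplication has at most one unit. -/
lemma enrichedEnd_eq {i : ι} (mon : MonObj (S.H i i))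
    (h : mon.mul ⊵ₗ M i ≫ S.ev i i = (αₗ _ _ _).hom ≫ S.H i i ⊴ₗ S.ev i i ≫ S.ev i i) :
    letI := S.enrichedCategory
    enrichedEnd D i = ⟨S.H i i⟩ := by
  change Mon.mk (mon := _) (S.H i i) = Mon.mk (S.H i i)
  congr 1
  exact MonObj.ext _ _ (S.comp_eq _ h)

end InternalHoms

/-! ### Free modules, and regular epimorphisms of modules -/

namespace RightMod

open MonoidalLeftAction

variable {D : Type*} [Category* D] [MonoidalCategory D] {B : Mon D}

variable (B) in
/-- The algebra `B` as a right module over itself. -/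
abbrev regular : RightMod B where
  X := B.X
  act := MonObj.mul
  act_one := MonObj.mul_one B.X
  act_act := MonObj.mul_assoc B.X

/-- The action of `B` on `N`, as a morphism of modules. -/
def actHom (N : RightMod B) : N.X ⊙ₗ regular B ⟶ N where
  hom := N.act
  act_hom := by
    change ((α_ N.X B.X B.X).hom ≫ N.X ◁ MonObj.mul) ≫ N.act = N.act ▷ B.X ≫ N.act
    rw [N.act_act, Category.assoc]

/-- `X ⊗ B` is the free module on `X`, so `N` is the internal hom from the regular module to `N`.
The inverse restricts a module map along the unit of `B`. -/
lemma actHom_bijective (N : RightMod B) (X : D) :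
    Function.Bijective fun g : X ⟶ N.X => g ⊵ₗ regular B ≫ N.actHom := by
  have key (g : X ⟶ N.X) : X ◁ MonObj.one ≫ g ▷ B.X ≫ N.act = (ρ_ X).hom ≫ g := by
    rw [whisker_exchange_assoc, N.act_one, rightUnitor_naturality]
  refine ⟨fun g g' h => ?_, fun f => ?_⟩
  · have h' : g ▷ B.X ≫ N.act = g' ▷ B.X ≫ N.act := congrArg Hom.hom h
    rw [← cancel_epi (ρ_ X).hom, ← key, ← key, h']
  · obtain ⟨t, h⟩ := f
    change X ⊗ B.X ⟶ N.X at t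
    change ((α_ X B.X B.X).hom ≫ X ◁ MonObj.mul) ≫ t = t ▷ B.X ≫ N.act at h
    refine ⟨(ρ_ X).inv ≫ X ◁ MonObj.one (X := B.X) ≫ t, ?_⟩
    ext
    change ((ρ_ X).inv ≫ X ◁ MonObj.one (X := B.X) ≫ t) ▷ B.X ≫ N.act = t
    calc _ = (ρ_ X).inv ▷ B.X ≫ (X ◁ MonObj.one) ▷ B.X ≫ t ▷ B.X ≫ N.act := by monoidal
      _ = 𝟙 _ ⊗≫ X ◁ (MonObj.one ▷ B.X ≫ MonObj.mul) ≫ t := by rw [← h]; monoidal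
      _ = t := by rw [MonObj.one_mul]; monoidal

/-- The action is the coequalizer of its two lifts to `(N ⊗ B) ⊗ B`. -/
lemma isRegularEpi_actHom (N : RightMod B) : IsRegularEpi N.actHom := by
  let u : (N.X ⊗ B.X) ⊙ₗ regular B ⟶ N.X ⊙ₗ regular B := N.act ⊵ₗ regular B
  let v : (N.X ⊗ B.X) ⊙ₗ regular B ⟶ N.X ⊙ₗ regular B :=
    (αₗ N.X B.X (regular B)).hom ≫ N.X ⊴ₗ (regular B).actHom
  have w : u ≫ N.actHom = v ≫ N.actHom := by
    ext
    change N.act ▷ B.X ≫ N.act = ((α_ N.X B.X B.X).hom ≫ N.X ◁ MonObj.mul) ≫ N.act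
    rw [N.act_act, Category.assoc]
  have hs : IsSplitEpi N.actHom.hom :=
    ⟨⟨(ρ_ N.X).inv ≫ N.X ◁ MonObj.one (X := B.X), by
      change ((ρ_ N.X).inv ≫ N.X ◁ MonObj.one) ≫ N.act = 𝟙 _
      rw [Category.assoc, N.act_one, Iso.inv_hom_id]⟩⟩
  have key {Z : RightMod B} (h : N.X ⊙ₗ regular B ⟶ Z) (e : u ≫ h = v ≫ h) :
      ∃ k : N ⟶ Z, N.actHom ≫ k = h := by
    obtain ⟨h, hh⟩ := h
    change N.X ⊗ B.X ⟶ Z.X at h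
    change ((α_ N.X B.X B.X).hom ≫ N.X ◁ MonObj.mul) ≫ h = h ▷ B.X ≫ Z.act at hh
    have e' : N.act ▷ B.X ≫ h = ((α_ N.X B.X B.X).hom ≫ N.X ◁ MonObj.mul) ≫ h :=
      congrArg Hom.hom e
    -- In the ambient category the fork is split by the unit of `B`, so the descended map must be
    -- the unit followed by `h`.
    have hk : N.act ≫ (ρ_ N.X).inv ≫ N.X ◁ MonObj.one ≫ h = h := by
      calc _ = (ρ_ _).inv ≫ (N.X ⊗ B.X) ◁ MonObj.one ≫ N.act ▷ B.X ≫ h := by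
            rw [whisker_exchange_assoc]; monoidal
        _ = 𝟙 _ ⊗≫ N.X ◁ (B.X ◁ MonObj.one ≫ MonObj.mul) ≫ h := by rw [e']; monoidal
        _ = _ := by rw [MonObj.mul_one]; monoidal
    refine ⟨⟨(ρ_ N.X).inv ≫ N.X ◁ MonObj.one ≫ h, ?_⟩, by ext; exact hk⟩
    rw [hk]
    calc _ = 𝟙 _ ⊗≫ N.X ◁ (MonObj.one ▷ B.X ≫ MonObj.mul) ≫ h := by
            rw [MonObj.one_mul]; monoidal
      _ = (ρ_ _).inv ▷ B.X ≫ (N.X ◁ MonObj.one) ▷ B.X ≫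
            ((α_ N.X B.X B.X).hom ≫ N.X ◁ MonObj.mul) ≫ h := by monoidal
      _ = _ := by rw [hh]; monoidal
  have : Epi N.actHom := ⟨fun g g' h => by
    ext
    rw [← cancel_epi N.actHom.hom]
    exact congrArg Hom.hom h⟩
  exact IsRegularEpi.of_exists_desc N.actHom u v w fun _ t e => key t e

/-- The forgetful functor to the ambient category preserves regular epimorphisms. -/
lemma isRegularEpi_hom [HasRightStableCoequalizers D] {M N : RightMod B} (f : M ⟶ N)
    [IsRegularEpi f] : IsRegularEpi f.hom := by
  let u := IsRegularEpi.left f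
  let v := IsRegularEpi.right f
  have w : u.hom ≫ f.hom = v.hom ≫ f.hom := congrArg Hom.hom (IsRegularEpi.w f)
  -- The coequalizer is formed in `D`. Its stability under tensoring with `B` provides an action on
  -- `Q`, and the resulting module is compared with `N` by the universal properties of `f` and `q`.
  obtain ⟨Q, q, hq, _, hdesc⟩ := HasRightStableCoequalizers.exists_coequalizer u.hom v.hom
  have _ : Epi q := epi_of_epi_whiskerRight_tensorUnit _
  obtain ⟨b, hb⟩ := hdesc B.X Q (M.act ≫ q) (by
    have hu : (IsRegularEpi.W f).act ≫ u.hom = u.hom ▷ B.X ≫ M.act := u.act_hom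
    have hv : (IsRegularEpi.W f).act ≫ v.hom = v.hom ▷ B.X ≫ M.act := v.act_hom
    rw [← reassoc_of% hu, ← reassoc_of% hv, hq])
  have _ : Epi (q ▷ B.X ▷ B.X) := by
    have e : q ▷ B.X ▷ B.X = (α_ _ _ _).hom ≫ q ▷ (B.X ⊗ B.X) ≫ (α_ _ _ _).inv := by simp
    rw [e]
    infer_instance
  let K : RightMod B :=
    { X := Q
      act := b
      act_one := by
        rw [← cancel_epi (q ▷ 𝟙_ D), ← whisker_exchange_assoc, hb, reassoc_of% M.act_one,
          rightUnitor_naturality]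
      act_act := by
        rw [← cancel_epi (q ▷ B.X ▷ B.X), ← comp_whiskerRight_assoc, hb, comp_whiskerRight_assoc,
          hb, reassoc_of% M.act_act, associator_naturality_left_assoc, ← whisker_exchange_assoc,
          hb] }
  let q' : M ⟶ K := ⟨q, hb.symm⟩
  obtain ⟨k, hk⟩ : ∃ k : N ⟶ K, f ≫ k = q' :=
    ⟨IsRegularEpi.desc f q' (by ext; exact hq), IsRegularEpi.fac f _ _⟩
  have hk' : f.hom ≫ k.hom = q := congrArg Hom.hom hk
  obtain ⟨j, hj⟩ := exists_desc_of_whiskerRight_tensorUnit hdesc f.hom w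
  let j' : K ⟶ N := ⟨j, by
    change b ≫ j = j ▷ B.X ≫ N.act
    rw [← cancel_epi (q ▷ B.X), reassoc_of% hb, hj, ← comp_whiskerRight_assoc, hj, f.act_hom]⟩
  have : Epi f := (IsRegularEpi.getStruct f).epi
  have hkj : k ≫ j' = 𝟙 N := by
    rw [← cancel_epi f, reassoc_of% hk, Category.comp_id]
    ext
    exact hj
  have : IsSplitEpi j := ⟨⟨k.hom, congrArg Hom.hom hkj⟩⟩
  have : Epi f.hom := by
    rw [← hj]
    infer_instance
  refine IsRegularEpi.of_exists_desc f.hom u.hom v.hom w fun Z t e => ?_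
  obtain ⟨l, hl⟩ := exists_desc_of_whiskerRight_tensorUnit hdesc t e
  exact ⟨k.hom ≫ l, by rw [reassoc_of% hk', hl]⟩

end RightMod

/-! ### The Morita context of a module equivalence -/

namespace RightMod

open MonoidalLeftAction

variable {D : Type*} [Category* D] [MonoidalCategory D]

section

variable {B : Mon D}

/-- This is the `B`-linearity of `f`, read as an equation of module maps. It identifies compositions
of internal homs that end in the regular module. -/
lemma actHom_naturality {N N' : RightMod B} {X : D} (f : X ⊙ₗ N ⟶ N') :
    f.hom ⊵ₗ regular B ≫ N'.actHom =
      (αₗ X N.X (regular B)).hom ≫ X ⊴ₗ N.actHom ≫ f := by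
  obtain ⟨f, hf⟩ := f
  change X ⊗ N.X ⟶ N'.X at f
  ext
  change f ▷ B.X ≫ N'.act = (α_ X N.X B.X).hom ≫ X ◁ N.act ≫ f
  exact hf.symm.trans (Category.assoc _ _ _)

variable (B) in
lemma mul_actHom : MonObj.mul (X := B.X) ⊵ₗ regular B ≫ (regular B).actHom =
    (αₗ B.X B.X (regular B)).hom ≫ B.X ⊴ₗ (regular B).actHom ≫ (regular B).actHom :=
  actHom_naturality (regular B).actHom

variable (B) in
/-- The family consisting of the regular module and a module `K`. -/
def regularAnd (K : RightMod B) : Bool → RightMod B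
  | false => regular B
  | true => K

/-- Internal homs between the regular module and a module `K`, given internal homs out of `K`. -/
def internalHoms {K : RightMod B} {T₀ T₁ : D} (ev₀ : T₀ ⊙ₗ K ⟶ regular B) (ev₁ : T₁ ⊙ₗ K ⟶ K)
    (h₀ : ∀ X : D, Function.Bijective fun g : X ⟶ T₀ => g ⊵ₗ K ≫ ev₀)
    (h₁ : ∀ X : D, Function.Bijective fun g : X ⟶ T₁ => g ⊵ₗ K ≫ ev₁) :
    InternalHoms D (regularAnd B K) where
  H
    | false, false => B.X
    | true, false => K.X
    | false, true => T₀
    | true, true => T₁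
  ev
    | false, false => (regular B).actHom
    | true, false => K.actHom
    | false, true => ev₀
    | true, true => ev₁
  bijective
    | false, false => (regular B).actHom_bijective
    | true, false => K.actHom_bijective
    | false, true => h₀
    | true, true => h₁

/-- A pair of algebras from a module with internal homs. -/
lemma exists_enrichedCategory {B' : Mon D} {K : RightMod B} {T₀ : D} (ev₀ : T₀ ⊙ₗ K ⟶ regular B)
    (ev₁ : B'.X ⊙ₗ K ⟶ K)
    (h₀ : ∀ X : D, Function.Bijective fun g : X ⟶ T₀ => g ⊵ₗ K ≫ ev₀)
    (h₁ : ∀ X : D, Function.Bijective fun g : X ⟶ B'.X => g ⊵ₗ K ≫ ev₁)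
    (hmul : MonObj.mul (X := B'.X) ⊵ₗ K ≫ ev₁ = (αₗ _ _ _).hom ≫ B'.X ⊴ₗ ev₁ ≫ ev₁)
    [IsRegularEpi ev₀.hom] (c : K.X ⊗ T₀ ⟶ B'.X)
    (hc : c ⊵ₗ K ≫ ev₁ = (αₗ _ _ _).hom ≫ K.X ⊴ₗ ev₀ ≫ K.actHom) [IsRegularEpi c] :
    ∃ _ : EnrichedCategory D Bool, enrichedEnd D false = B ∧ enrichedEnd D true = B' ∧
      IsRegularEpi (eComp D false true false) ∧ IsRegularEpi (eComp D true false true) := by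
  let S := internalHoms ev₀ ev₁ h₀ h₁
  refine ⟨S.enrichedCategory, S.enrichedEnd_eq (i := false) B.mon ?_,
    S.enrichedEnd_eq (i := true) B'.mon hmul, ?_, ?_⟩
  · exact mul_actHom B
  -- The composition `T₀ ⊗ K ⟶ B` is evaluation itself, since an element of `K` is a map from the
  -- regular module to `K`.
  · have e : S.comp false true false = ev₀.hom := S.comp_eq (i := false) (j := true) (k := false)
      ev₀.hom (by
        exact actHom_naturality ev₀)
    change IsRegularEpi (S.comp false true false)
    rw [e]
    assumption
  · have e : S.comp true false true = c := S.comp_eq (i := true) (j := false) (k := true) c hc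
    change IsRegularEpi (S.comp true false true)
    rw [e]
    assumption

end

section

open Functor LaxLeftLinear OplaxLeftLinear

variable {B B' : Mon D} (F : RightMod B ⥤ RightMod B') [F.IsEquivalence] [F.LeftLinear D]
  {K : RightMod B} (e : F.obj K ≅ regular B')

/-- If `F` maps `K` to the regular module, then the underlying object of `F N` is the internal hom
from `K` to `N`. -/
noncomputable def evOfIso {N : RightMod B} {N' : RightMod B'} (j : F.obj N ≅ N') :
    N'.X ⊙ₗ K ⟶ N :=
  F.preimage (δₗ F N'.X K ≫ N'.X ⊴ₗ e.hom ≫ N'.actHom ≫ j.inv)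

lemma map_evOfIso {N : RightMod B} {N' : RightMod B'} (j : F.obj N ≅ N') :
    F.map (evOfIso F e j) = δₗ F N'.X K ≫ N'.X ⊴ₗ e.hom ≫ N'.actHom ≫ j.inv :=
  F.map_preimage _

lemma map_whiskerRight_evOfIso {N : RightMod B} {N' : RightMod B'} (j : F.obj N ≅ N') {X : D}
    (g : X ⟶ N'.X) : F.map (g ⊵ₗ K ≫ evOfIso F e j) =
      δₗ F X K ≫ X ⊴ₗ e.hom ≫ (g ⊵ₗ regular B' ≫ N'.actHom) ≫ j.inv := by
  rw [F.map_comp, map_evOfIso, δₗ_naturality_left_assoc, ← action_exchange_assoc, Category.assoc]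

/-- Maps `X ⊙ₗ K ⟶ N` correspond under `F` to maps from `X ⊙ₗ regular B'` to `N'`, hence to maps `X
⟶ N'.X` by freeness. -/
lemma evOfIso_bijective {N : RightMod B} {N' : RightMod B'} (j : F.obj N ≅ N') (X : D) :
    Function.Bijective fun g : X ⟶ N'.X => g ⊵ₗ K ≫ evOfIso F e j := by
  refine ⟨fun g g' h => ?_, fun f => ?_⟩
  · have h' := congrArg F.map h
    simp only [map_whiskerRight_evOfIso] at h'
    rw [cancel_epi, cancel_epi, cancel_mono] at h'
    exact (N'.actHom_bijective X).1 h'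
  · obtain ⟨g, hg⟩ := (N'.actHom_bijective X).2 (X ⊴ₗ e.inv ≫ μₗ F X K ≫ F.map f ≫ j.hom)
    refine ⟨g, F.map_injective ?_⟩
    simp only at hg
    simp only [map_whiskerRight_evOfIso]
    rw [hg]
    simp

/-- Up to isomorphisms, `F` sends the evaluation to the action map of `N'`, which is a regular
epimorphism. -/
instance {N : RightMod B} {N' : RightMod B'} (j : F.obj N ≅ N') :
    IsRegularEpi (evOfIso F e j) := by
  have : IsRegularEpi (F.map (evOfIso F e j)) := by
    rw [map_evOfIso]
    have := N'.isRegularEpi_actHom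
    have := IsRegularEpi.comp_iso N'.actHom j.inv
    have := IsRegularEpi.iso_comp (N'.X ⊴ₗ e.hom) (N'.actHom ≫ j.inv)
    exact IsRegularEpi.iso_comp _ _
  exact IsRegularEpi.of_map_of_isEquivalence F _

end

end RightMod

open MonoidalLeftAction Functor LaxLeftLinear OplaxLeftLinear in
/-- Morita equivalent algebras are the endomorphism algebras of the objects of an enriched category
with two objects in which the identities are, locally, compositions of morphisms through the other
object. -/
theorem MoritaEquivalent.exists_enrichedCategory {D : Type*} [Category* D] [MonoidalCategory D]
    [HasRightStableCoequalizers D] {B B' : Mon D} (h : MoritaEquivalent B B') :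
    ∃ _ : EnrichedCategory D Bool, enrichedEnd D false = B ∧ enrichedEnd D true = B' ∧
      IsRegularEpi (eComp D false true false) ∧ IsRegularEpi (eComp D true false true) := by
  obtain ⟨F, _, ⟨_⟩⟩ := h
  let K := F.objPreimage (RightMod.regular B')
  let e : F.obj K ≅ RightMod.regular B' := F.objObjPreimageIso _
  let ev₀ := RightMod.evOfIso F e (Iso.refl (F.obj (RightMod.regular B)))
  let ev₁ : B'.X ⊙ₗ K ⟶ K := RightMod.evOfIso F e e
  -- The composition through `B`: the action of `B` on `K`, carried along `F` and `F K ≅ B'`.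
  let c : K.X ⊙ₗ F.obj (RightMod.regular B) ⟶ RightMod.regular B' :=
    μₗ F K.X (RightMod.regular B) ≫ F.map K.actHom ≫ e.hom
  have : IsRegularEpi ev₀.hom := RightMod.isRegularEpi_hom _
  have : IsRegularEpi c := by
    have := K.isRegularEpi_actHom
    have := IsRegularEpi.map_of_isEquivalence F K.actHom
    have := IsRegularEpi.comp_iso (F.map K.actHom) e.hom
    exact IsRegularEpi.iso_comp _ _
  let c' : K.X ⊗ (F.obj (RightMod.regular B)).X ⟶ B'.X := c.hom
  have : IsRegularEpi c' := RightMod.isRegularEpi_hom c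
  refine RightMod.exists_enrichedCategory (T₀ := (F.obj (RightMod.regular B)).X) ev₀ ev₁
    (RightMod.evOfIso_bijective F e _) (RightMod.evOfIso_bijective F e e) ?_ c' ?_
  · apply F.map_injective
    refine (RightMod.map_whiskerRight_evOfIso F e e _).trans ?_
    have hev : F.map ev₁ = δₗ F B'.X K ≫ B'.X ⊴ₗ e.hom ≫
        (RightMod.regular B').actHom ≫ e.inv := RightMod.map_evOfIso F e e
    rw [RightMod.mul_actHom, F.map_comp, F.map_comp, hev, δₗ_naturality_right_assoc, hev]
    simp
  · apply F.map_injective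
    refine (RightMod.map_whiskerRight_evOfIso F e e _).trans ?_
    have hev : F.map ev₀ = _ := RightMod.map_evOfIso F e _
    have hc : c' ⊵ₗ RightMod.regular B' ≫ (RightMod.regular B').actHom =
      (αₗ K.X (F.obj (RightMod.regular B)).X (RightMod.regular B')).hom ≫
        K.X ⊴ₗ (F.obj (RightMod.regular B)).actHom ≫ c := RightMod.actHom_naturality c
    rw [hc]
    have h : F.map (K.X ⊴ₗ ev₀) =
        δₗ F K.X _ ≫ K.X ⊴ₗ F.map ev₀ ≫ μₗ F K.X (RightMod.regular B) := by
      rw [← δₗ_naturality_right_assoc]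
      simp
    rw [F.map_comp, F.map_comp, h, hev]
    simp [c]

/-! ### Generators in categories where epimorphisms are regular -/

section

variable {C : Type*} [Category* C] [MonoidalCategory C]

section

variable [HasCoequalizers C] [∀ X : C, PreservesColimitsOfSize.{0, 0} (tensorRight X)]

instance : HasRightStableCoequalizers C where
  exists_coequalizer f g := by
    refine ⟨_, coequalizer.π f g, coequalizer.condition f g,
      fun X => inferInstanceAs (Epi ((tensorRight X).map (coequalizer.π f g))), fun X Z h w => ?_⟩
    exact ⟨_, map_π_preserves_coequalizer_inv_desc (tensorRight X) f g h w⟩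

end

lemma epi_whiskerLeft [∀ X : C, PreservesColimitsOfSize.{0, 0} (tensorLeft X)]
    (X : C) {Y Z : C} (f : Y ⟶ Z) [Epi f] : Epi (X ◁ f) :=
  inferInstanceAs (Epi ((tensorLeft X).map f))

lemma epi_whiskerRight [∀ X : C, PreservesColimitsOfSize.{0, 0} (tensorRight X)]
    (X : C) {Y Z : C} (f : Y ⟶ Z) [Epi f] : Epi (f ▷ X) :=
  inferInstanceAs (Epi ((tensorRight X).map f))

section

variable [∀ X : C, PreservesColimitsOfSize.{0, 0} (tensorLeft X)]
  [∀ X : C, PreservesColimitsOfSize.{0, 0} (tensorRight X)] [IsRegularEpiCategory C]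
  {ι : Type*} [EnrichedCategory C ι]

/-- This is the argument of Morita theory by which a surjective composition is automatically
injective on the balanced tensor product. For `h = f' ≫ g'` through `i`, balancedness gives `t (m,
f, g ≫ h) = t (m, f ≫ g ≫ f', g')`, which depends only on `m` and `f ≫ g`. Such `h` suffice because
the composition is epi, and `h = 𝟙` gives the result. -/
lemma isEnrichedGenerator_of_epi {i : ι} (h : ∀ j : ι, Epi (eComp C j i j)) :
    IsEnrichedGenerator C i where
  epi_comp_whiskerRight j M X :=
    have := epi_whiskerLeft M (eComp C j i j)
    epi_whiskerRight X _
  exists_desc j M Z t ht := by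
    have : Epi (M ◁ eComp C j i j) := epi_whiskerLeft M _
    have := IsRegularEpiCategory.regularEpiOfEpi (M ◁ eComp C j i j)
    -- Composes the last factor with an additional endomorphism of `j`.
    let r : (M ⊗ (j ⟶[C] i) ⊗ (i ⟶[C] j)) ⊗ (j ⟶[C] j) ⟶ M ⊗ (j ⟶[C] i) ⊗ (i ⟶[C] j) :=
      𝟙 _ ⊗≫ M ◁ (j ⟶[C] i) ◁ eComp C i j j
    have key : (M ⊗ (j ⟶[C] i) ⊗ (i ⟶[C] j)) ◁ eComp C j i j ≫ r ≫ t =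
        (M ◁ eComp C j i j) ▷ ((j ⟶[C] i) ⊗ (i ⟶[C] j)) ≫
          (𝟙 _ ⊗≫ M ◁ (eComp C j j i ▷ (i ⟶[C] j)) ≫ t) := by
      calc _ = 𝟙 _ ⊗≫ M ◁ (j ⟶[C] i) ◁ ((i ⟶[C] j) ◁ eComp C j i j ≫ eComp C i j j) ≫ t := by
            monoidal
        _ = 𝟙 _ ⊗≫ (M ◁ ((j ⟶[C] i) ◁ (eComp C i j i ▷ (i ⟶[C] j)))) ≫
              M ◁ (j ⟶[C] i) ◁ eComp C i i j ≫ t := by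
            rw [← e_assoc]; monoidal
        _ = 𝟙 _ ⊗≫ (M ◁ ((j ⟶[C] i) ◁ (eComp C i j i ▷ (i ⟶[C] j)))) ⊗≫
              (M ◁ ((α_ _ _ _).hom ≫ (j ⟶[C] i) ◁ eComp C i i j) ≫ t) := by monoidal
        _ = 𝟙 _ ⊗≫ M ◁ (((j ⟶[C] i) ◁ eComp C i j i ≫ eComp C j i i) ▷ (i ⟶[C] j)) ≫ t := by
            rw [← ht]; monoidal
        _ = _ := by rw [← e_assoc]; monoidal
    have hr : t = (ρ_ _).inv ≫ (M ⊗ (j ⟶[C] i) ⊗ (i ⟶[C] j)) ◁ eId C j ≫ r ≫ t := by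
      symm
      calc _ = 𝟙 _ ⊗≫ M ◁ (j ⟶[C] i) ◁ ((i ⟶[C] j) ◁ eId C j ≫ eComp C i j j) ≫ t := by
            monoidal
        _ = _ := by rw [whiskerLeft_eId_eComp]; monoidal
    have hu (W : C) (u : W ⟶ M ⊗ (j ⟶[C] i) ⊗ (i ⟶[C] j)) :
        W ◁ eComp C j i j ≫ u ▷ (j ⟶[C] j) ≫ r ≫ t =
          (u ≫ M ◁ eComp C j i j) ▷ ((j ⟶[C] i) ⊗ (i ⟶[C] j)) ≫
          (𝟙 _ ⊗≫ M ◁ (eComp C j j i ▷ (i ⟶[C] j)) ≫ t) := by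
      rw [whisker_exchange_assoc, key, comp_whiskerRight_assoc]
    refine ⟨IsRegularEpi.desc (M ◁ eComp C j i j) t ?_, IsRegularEpi.fac _ _ _⟩
    have hw := IsRegularEpi.w (M ◁ eComp C j i j)
    generalize IsRegularEpi.left (M ◁ eComp C j i j) = u at hw ⊢
    generalize IsRegularEpi.right (M ◁ eComp C j i j) = v at hw ⊢
    generalize IsRegularEpi.W (M ◁ eComp C j i j) = W at u v hw ⊢
    have : Epi (W ◁ eComp C j i j) := epi_whiskerLeft W _
    -- The maps `u` and `v` form the pair whose coequalizer is `M ◁ eComp C j i j`; they agree after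
    -- `t` with any endomorphism inserted, in particular the identity.
    have e : u ▷ (j ⟶[C] j) ≫ r ≫ t = v ▷ (j ⟶[C] j) ≫ r ≫ t := by
      rw [← cancel_epi (W ◁ eComp C j i j), hu, hu, hw]
    rw [hr, rightUnitor_inv_naturality_assoc, rightUnitor_inv_naturality_assoc,
      ← whisker_exchange_assoc, ← whisker_exchange_assoc, e]

end

instance (D : Type*) [Category* D] [MonoidalCategory D] {ι : Type*} [EnrichedCategory D ι] (i : ι) :
    IsSplitEpi (eComp D i i i) :=
  ⟨⟨(λ_ _).inv ≫ eId D i ▷ _, by rw [Category.assoc, e_id_comp]⟩⟩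

lemma isEnrichedGenerator_false [∀ X : C, PreservesColimitsOfSize.{0, 0} (tensorLeft X)]
    [∀ X : C, PreservesColimitsOfSize.{0, 0} (tensorRight X)] [IsRegularEpiCategory C]
    [EnrichedCategory C Bool] [Epi (eComp C true false true)] :
    IsEnrichedGenerator C false :=
  isEnrichedGenerator_of_epi fun
    | false => inferInstance
    | true => inferInstance

lemma isEnrichedGenerator_true [∀ X : C, PreservesColimitsOfSize.{0, 0} (tensorLeft X)]
    [∀ X : C, PreservesColimitsOfSize.{0, 0} (tensorRight X)] [IsRegularEpiCategory C]
    [EnrichedCategory C Bool] [Epi (eComp C false true false)] :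
    IsEnrichedGenerator C true :=
  isEnrichedGenerator_of_epi fun
    | false => inferInstance
    | true => inferInstance

end

/-! ### Coequalizers, generators and the forgetful functor for bimodules -/

namespace Bimod

variable {C : Type*} [Category* C] [MonoidalCategory C] {A : Mon C}

lemma epi_of_epi_hom {M N : Bimod A A} (f : M ⟶ N) [Epi f.hom] : Epi f where
  left_cancellation g h e := by
    ext
    rw [← cancel_epi f.hom]
    exact congrArg Hom.hom e

variable [HasCoequalizers C]
  [∀ X : C, PreservesColimitsOfSize.{0, 0} (tensorLeft X)]
  [∀ X : C, PreservesColimitsOfSize.{0, 0} (tensorRight X)]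

lemma proj_condition (M N : Bimod A A) :
    M.actRight ▷ N.X ≫ proj M N = (α_ _ _ _).hom ≫ M.X ◁ N.actLeft ≫ proj M N :=
  (coequalizer.condition _ _).trans (Category.assoc _ _ _)

section

variable {M N P : Bimod A A} (φ : M ⊗ N ⟶ P)

lemma proj_hom_balanced : M.actRight ▷ N.X ≫ proj M N ≫ φ.hom =
    (α_ _ _ _).hom ≫ M.X ◁ N.actLeft ≫ proj M N ≫ φ.hom := by
  rw [reassoc_of% proj_condition M N]

lemma proj_hom_actLeft : M.actLeft ▷ N.X ≫ proj M N ≫ φ.hom =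
    (α_ _ _ _).hom ≫ A.X ◁ (proj M N ≫ φ.hom) ≫ P.actLeft := by
  rw [MonoidalCategory.whiskerLeft_comp_assoc, ← φ.left_act_hom, reassoc_of% proj_actLeft M N,
    Iso.hom_inv_id_assoc]

lemma proj_hom_actRight : M.X ◁ N.actRight ≫ proj M N ≫ φ.hom =
    (α_ _ _ _).inv ≫ (proj M N ≫ φ.hom) ▷ A.X ≫ P.actRight := by
  rw [comp_whiskerRight_assoc, ← φ.right_act_hom, reassoc_of% proj_actRight M N,
    Iso.inv_hom_id_assoc]

end

/-- Coequalizers of bimodules are coequalizers in the ambient category and are preserved by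
`⊗_A` on the right. -/
lemma exists_coequalizer {M N : Bimod A A} (f g : M ⟶ N) :
    ∃ (Q : Bimod A A) (q : N ⟶ Q), f ≫ q = g ≫ q ∧ Epi q.hom ∧
      ∀ (X Z : Bimod A A) (h : N ⊗ X ⟶ Z), f ▷ X ≫ h = g ▷ X ≫ h → ∃ k, q ▷ X ≫ k = h := by
  let q := coequalizer.π f.hom g.hom
  have hq : f.hom ≫ q = g.hom ≫ q := coequalizer.condition _ _
  have hl (X : C) : Epi (X ◁ q) := epi_whiskerLeft _ _
  have hr (X : C) : Epi (q ▷ X) := epi_whiskerRight _ _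
  have hlr (X Y : C) : Epi ((X ◁ q) ▷ Y) := epi_whiskerRight _ _
  have hrr (X Y : C) : Epi ((q ▷ X) ▷ Y) := epi_whiskerRight _ _
  have hll (X Y : C) : Epi (X ◁ (Y ◁ q)) := epi_whiskerLeft _ _
  obtain ⟨aL, haL⟩ : ∃ aL, A.X ◁ q ≫ aL = N.actLeft ≫ q :=
    ⟨_, map_π_preserves_coequalizer_inv_desc (tensorLeft A.X) f.hom g.hom (N.actLeft ≫ q) (by
      change A.X ◁ f.hom ≫ N.actLeft ≫ q = A.X ◁ g.hom ≫ N.actLeft ≫ q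
      rw [← reassoc_of% f.left_act_hom, ← reassoc_of% g.left_act_hom, hq])⟩
  obtain ⟨aR, haR⟩ : ∃ aR, q ▷ A.X ≫ aR = N.actRight ≫ q :=
    ⟨_, map_π_preserves_coequalizer_inv_desc (tensorRight A.X) f.hom g.hom (N.actRight ≫ q) (by
      change f.hom ▷ A.X ≫ N.actRight ≫ q = g.hom ▷ A.X ≫ N.actRight ≫ q
      rw [← reassoc_of% f.right_act_hom, ← reassoc_of% g.right_act_hom, hq])⟩
  let Q : Bimod A A :=
    { X := coequalizer f.hom g.hom
      actLeft := aL
      actRight := aR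
      one_actLeft := by
        rw [← cancel_epi (𝟙_ C ◁ q), whisker_exchange_assoc, haL, reassoc_of% N.one_actLeft,
          leftUnitor_naturality]
      left_assoc := by
        rw [← cancel_epi ((A.X ⊗ A.X) ◁ q), whisker_exchange_assoc, haL,
          reassoc_of% N.left_assoc, associator_naturality_right_assoc,
          ← MonoidalCategory.whiskerLeft_comp_assoc, haL,
          MonoidalCategory.whiskerLeft_comp_assoc, haL]
      actRight_one := by
        rw [← cancel_epi (q ▷ 𝟙_ C), ← whisker_exchange_assoc, haR, reassoc_of% N.actRight_one,
          rightUnitor_naturality]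
      right_assoc := by
        rw [← cancel_epi (q ▷ (A.X ⊗ A.X)), ← whisker_exchange_assoc, haR,
          reassoc_of% N.right_assoc, associator_inv_naturality_left_assoc,
          ← comp_whiskerRight_assoc, haR, comp_whiskerRight_assoc, haR]
      middle_assoc := by
        rw [← cancel_epi ((A.X ◁ q) ▷ A.X), ← comp_whiskerRight_assoc, haL,
          comp_whiskerRight_assoc, haR, reassoc_of% N.middle_assoc,
          associator_naturality_middle_assoc,
          ← MonoidalCategory.whiskerLeft_comp_assoc, haR,
          MonoidalCategory.whiskerLeft_comp_assoc, haL] }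
  let q' : N ⟶ Q := { hom := q, left_act_hom := haL.symm, right_act_hom := haR.symm }
  refine ⟨Q, q', by ext; exact hq, inferInstanceAs (Epi q), fun X Z h w => ?_⟩
  have w' : f.hom ▷ X.X ≫ proj N X ≫ h.hom = g.hom ▷ X.X ≫ proj N X ≫ h.hom := by
    rw [← reassoc_of% proj_whiskerRight f X, ← reassoc_of% proj_whiskerRight g X]
    exact congrArg (fun t => proj M X ≫ t) (congrArg Hom.hom w)
  obtain ⟨k, hk⟩ : ∃ k, q ▷ X.X ≫ k = proj N X ≫ h.hom :=
    ⟨_, map_π_preserves_coequalizer_inv_desc (tensorRight X.X) f.hom g.hom _ w'⟩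
  refine ⟨lift (M := Q) (N := X) (P := Z) k ?_ ?_ ?_, ?_⟩
  · change aR ▷ X.X ≫ k = (α_ _ _ _).hom ≫ _ ◁ X.actLeft ≫ k
    rw [← cancel_epi ((q ▷ A.X) ▷ X.X), ← comp_whiskerRight_assoc, haR, comp_whiskerRight_assoc,
      hk, associator_naturality_left_assoc, ← whisker_exchange_assoc, hk, proj_hom_balanced]
  · change aL ▷ X.X ≫ k = (α_ _ _ _).hom ≫ A.X ◁ k ≫ Z.actLeft
    rw [← cancel_epi ((A.X ◁ q) ▷ X.X), ← comp_whiskerRight_assoc, haL, comp_whiskerRight_assoc,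
      hk, associator_naturality_middle_assoc, ← MonoidalCategory.whiskerLeft_comp_assoc, hk,
      proj_hom_actLeft]
  · change _ ◁ X.actRight ≫ k = (α_ _ _ _).inv ≫ k ▷ A.X ≫ Z.actRight
    rw [← cancel_epi (q ▷ (X.X ⊗ A.X)), ← whisker_exchange_assoc, hk,
      associator_inv_naturality_left_assoc, ← comp_whiskerRight_assoc, hk,
      proj_hom_actRight]
  · ext
    rw [← cancel_epi (proj N X), Bimod.comp_hom', reassoc_of% proj_whiskerRight q' X]
    exact (congrArg (fun t => q ▷ X.X ≫ t) (proj_lift (M := Q) k _ _ _)).trans hk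

lemma epi_hom_whiskerRight {M N : Bimod A A} (f : M ⟶ N) [Epi f.hom] (X : Bimod A A) :
    Epi (f ▷ X).hom := by
  have : Epi (f.hom ▷ X.X) := epi_whiskerRight _ _
  have : Epi (proj M X ≫ (f ▷ X).hom) := by
    rw [proj_whiskerRight]
    infer_instance
  exact epi_of_epi (proj M X) _

lemma epi_hom_whiskerLeft (X : Bimod A A) {M N : Bimod A A} (f : M ⟶ N) [Epi f.hom] :
    Epi (X ◁ f).hom := by
  have : Epi (X.X ◁ f.hom) := epi_whiskerLeft _ _
  have : Epi (proj X M ≫ (X ◁ f).hom) := by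
    rw [proj_whiskerLeft]
    infer_instance
  exact epi_of_epi (proj X M) _

instance : HasRightStableCoequalizers (Bimod A A) where
  exists_coequalizer f g := by
    obtain ⟨Q, q, hq, _, h⟩ := exists_coequalizer f g
    refine ⟨Q, q, hq, fun X => ?_, h⟩
    have := epi_hom_whiskerRight q X
    exact epi_of_epi_hom _

/-- The coequalizer of the same pair can be built on the coequalizer in `C`, where its projection is
epi; `f` is that projection followed by a split epimorphism. -/
lemma epi_hom_of_isRegularEpi {M N : Bimod A A} (f : M ⟶ N) [IsRegularEpi f] : Epi f.hom := by
  obtain ⟨Q, q, hq, _, hdesc⟩ := exists_coequalizer (IsRegularEpi.left f) (IsRegularEpi.right f)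
  obtain ⟨j, hj⟩ := exists_desc_of_whiskerRight_tensorUnit hdesc f (IsRegularEpi.w f)
  have hk : f ≫ IsRegularEpi.desc f q hq = q := IsRegularEpi.fac f _ _
  have : Epi f := (IsRegularEpi.getStruct f).epi
  have hkj : IsRegularEpi.desc f q hq ≫ j = 𝟙 N := by
    rw [← cancel_epi f, reassoc_of% hk, hj, Category.comp_id]
  have : IsSplitEpi j.hom := ⟨⟨(IsRegularEpi.desc f q hq).hom, congrArg Hom.hom hkj⟩⟩
  rw [← hj]
  exact epi_comp q.hom j.hom

/-- Descent of bimodule maps along `M ⊗_A c` for a bimodule map `c` that is an epimorphism in the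
ambient category. -/
lemma exists_whiskerLeft_desc {M P R Z : Bimod A A} (c : P ⟶ R) [Epi c.hom] (t : M ⊗ P ⟶ Z)
    (k : M.X ⊗ R.X ⟶ Z.X) (hk : M.X ◁ c.hom ≫ k = proj M P ≫ t.hom) :
    ∃ k' : M ⊗ R ⟶ Z, M ◁ c ≫ k' = t := by
  have hl (X : C) : Epi (X ◁ c.hom) := epi_whiskerLeft _ _
  have : Epi (M.X ◁ c.hom ▷ A.X) :=
    have := epi_whiskerRight A.X c.hom
    epi_whiskerLeft _ _
  refine ⟨lift k ?_ ?_ ?_, ?_⟩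
  · rw [← cancel_epi ((M.X ⊗ A.X) ◁ c.hom), whisker_exchange_assoc, hk, proj_hom_balanced,
      associator_naturality_right_assoc, ← MonoidalCategory.whiskerLeft_comp_assoc,
      ← c.left_act_hom, MonoidalCategory.whiskerLeft_comp_assoc, hk]
  · rw [← cancel_epi ((A.X ⊗ M.X) ◁ c.hom), whisker_exchange_assoc, hk, proj_hom_actLeft,
      associator_naturality_right_assoc, ← MonoidalCategory.whiskerLeft_comp_assoc, hk]
  · rw [← cancel_epi (M.X ◁ c.hom ▷ A.X), ← MonoidalCategory.whiskerLeft_comp_assoc,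
      ← c.right_act_hom, MonoidalCategory.whiskerLeft_comp_assoc, hk, proj_hom_actRight,
      associator_inv_naturality_middle_assoc, ← comp_whiskerRight_assoc, hk]
  · ext
    rw [← cancel_epi (proj M P), Bimod.comp_hom', reassoc_of% proj_whiskerLeft M c, proj_lift, hk]

/-- Translates balancedness over an algebra of bimodules into balancedness for the tensor product of
`C`, as needed to apply the generator property of the transported category. -/
lemma proj_balanced {M P Q R Z : Bimod A A} (a : P ⊗ Q ⟶ P) (b : Q ⊗ R ⟶ R) (t : M ⊗ P ⊗ R ⟶ Z)
    (ht : M ◁ (a ▷ R) ≫ t = M ◁ ((α_ P Q R).hom ≫ P ◁ b) ≫ t) :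
    M.X ◁ ((proj P Q ≫ a.hom) ▷ R.X) ≫ M.X ◁ proj P R ≫ proj M (P ⊗ R) ≫ t.hom =
      M.X ◁ ((α_ P.X Q.X R.X).hom ≫ P.X ◁ (proj Q R ≫ b.hom)) ≫
        M.X ◁ proj P R ≫ proj M (P ⊗ R) ≫ t.hom := by
  have h₁ : (proj P Q ≫ a.hom) ▷ R.X ≫ proj P R =
      proj P Q ▷ R.X ≫ proj (P ⊗ Q) R ≫ (a ▷ R).hom := by
    rw [proj_whiskerRight, comp_whiskerRight_assoc]
  have h₂ : ((α_ P.X Q.X R.X).hom ≫ P.X ◁ (proj Q R ≫ b.hom)) ≫ proj P R =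
      proj P Q ▷ R.X ≫ proj (P ⊗ Q) R ≫ ((α_ P Q R).hom ≫ P ◁ b).hom := by
    rw [Bimod.comp_hom', reassoc_of% proj_associator P Q R, proj_whiskerLeft,
      MonoidalCategory.whiskerLeft_comp, Category.assoc, Category.assoc]
  have h₃ (f : (P ⊗ Q) ⊗ R ⟶ P ⊗ R) :
      M.X ◁ f.hom ≫ proj M (P ⊗ R) ≫ t.hom = proj M _ ≫ (M ◁ f ≫ t).hom := by
    rw [Bimod.comp_hom', reassoc_of% proj_whiskerLeft M f]
  rw [← MonoidalCategory.whiskerLeft_comp_assoc, ← MonoidalCategory.whiskerLeft_comp_assoc, h₁, h₂]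
  simp only [MonoidalCategory.whiskerLeft_comp_assoc]
  rw [h₃, ht, ← h₃]

variable (A) in
/-- The forgetful functor from bimodules to the ambient category. -/
@[simps]
def forgetBoth : Bimod A A ⥤ C where
  obj M := M.X
  map f := f.hom

/-- The forgetful functor from bimodules is lax monoidal. -/
noncomputable instance : (forgetBoth A).LaxMonoidal where
  ε := MonObj.one (X := A.X)
  μ M N := proj M N
  μ_natural_left f N := (proj_whiskerRight f N).symm
  μ_natural_right M f := (proj_whiskerLeft M f).symm
  associativity M N P := proj_associator M N P
  left_unitality M := by
    exact M.one_actLeft.symm.trans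
      (congrArg (fun t => MonObj.one (X := A.X) ▷ M.X ≫ t) (proj_leftUnitor M).symm)
  right_unitality M := by
    exact M.actRight_one.symm.trans
      (congrArg (fun t => M.X ◁ MonObj.one (X := A.X) ≫ t) (proj_rightUnitor M).symm)

variable {ι : Type*} [EnrichedCategory (Bimod A A) ι]

/-- Generators are detected in the ambient category. -/
lemma isEnrichedGenerator {i : ι}
    (h : IsEnrichedGenerator C (ι := TransportEnrichment (forgetBoth A) ι) i) :
    IsEnrichedGenerator (Bimod A A) i := by
  have hc (j : ι) : Epi (eComp (Bimod A A) j i j).hom := by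
    have h₁ : Epi (eComp C (C := TransportEnrichment (forgetBoth A) ι) j i j) := by
      have := h.epi_comp j (𝟙_ C)
      exact epi_of_epi_tensorUnit_whiskerLeft _
    have h₂ : Epi (proj _ _ ≫ (eComp (Bimod A A) j i j).hom) := h₁
    exact epi_of_epi (proj _ _) _
  refine ⟨fun j M X => ?_, fun j M Z t ht => ?_⟩
  · have := hc j
    have := epi_hom_whiskerLeft M (eComp (Bimod A A) j i j)
    have := epi_hom_whiskerRight (M ◁ eComp (Bimod A A) j i j) X
    exact epi_of_epi_hom _
  -- The descent takes place in `C`; as the composition is epi there, the result is again a map of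
  -- bimodules out of the tensor product over `A`.
  · obtain ⟨k, hk⟩ : ∃ k : M.X ⊗ (j ⟶[Bimod A A] j).X ⟶ Z.X,
        M.X ◁ (proj (j ⟶[Bimod A A] i) (i ⟶[Bimod A A] j) ≫ (eComp (Bimod A A) j i j).hom) ≫ k =
          M.X ◁ proj (j ⟶[Bimod A A] i) (i ⟶[Bimod A A] j) ≫ proj M _ ≫ t.hom :=
      h.exists_desc j M.X Z.X _ (proj_balanced _ _ t ht)
    have := hc j
    refine exists_whiskerLeft_desc _ t k ?_
    rw [← cancel_epi (M.X ◁ proj (j ⟶[Bimod A A] i) (i ⟶[Bimod A A] j)), ← hk,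
      MonoidalCategory.whiskerLeft_comp_assoc]

end Bimod

lemma MoritaEquivalent.symm {C : Type*} [Category* C] [MonoidalCategory C] {A B : Mon C}
    (h : MoritaEquivalent A B) : MoritaEquivalent B A := by
  obtain ⟨F, _, ⟨_⟩⟩ := h
  exact ⟨F.inv, inferInstance, ⟨Functor.LeftLinear.inv F⟩⟩

/-! ### `Φ(B)` as the internal endomorphism algebra of `A ⊗ B` -/

namespace FrobAlg

open MonObj ComonObj MonoidalLeftAction

variable {C : Type*} [Category* C] [MonoidalCategory C] (A : FrobAlg C)

/-- The pairing of a Frobenius algebra. -/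
abbrev pairing : A.X ⊗ A.X ⟶ 𝟙_ C := μ[A.X] ≫ ε[A.X]

/-- A Frobenius algebra is dual to itself. -/
@[reducible]
def exactPairing : ExactPairing A.X A.X where
  coevaluation' := η[A.X] ≫ Δ[A.X]
  evaluation' := A.pairing
  coevaluation_evaluation' := by
    rw [MonoidalCategory.whiskerLeft_comp_assoc, A.comul_pairing, MonObj.mul_one_assoc]
  evaluation_coevaluation' := by
    rw [comp_whiskerRight_assoc, A.comul_pairing', MonObj.one_mul_assoc]

/-- Evaluating `ε m` on `u ⊗ u` gives `ε u = φ`, so `φ⁻¹` times `u ⊗ u` is a section. -/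
lemma isSplitEpi_pairing {𝕜 : Type*} [Field 𝕜] [Preadditive C] [Linear 𝕜 C]
    (hA : A.IsSpecial 𝕜) : IsSplitEpi A.pairing := by
  obtain ⟨-, φ, hφ, h⟩ := hA
  have e : (η[A.X] ≫ (λ_ A.X).inv ≫ η[A.X] ▷ A.X) ≫ A.pairing = φ • 𝟙 (𝟙_ C) := by
    rw [pairing, Category.assoc, Category.assoc, MonObj.one_mul_assoc, Iso.inv_hom_id_assoc, h]
  exact ⟨⟨φ⁻¹ • (η[A.X] ≫ (λ_ A.X).inv ≫ η[A.X] ▷ A.X), by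
    rw [Linear.smul_comp, e, smul_smul, inv_mul_cancel₀ hφ, one_smul]⟩⟩

section

variable {B : Mon C} (N : RightMod B)

/-- The morphism `(N ⊗ A) ⊗ A ⟶ N` given by the pairing. -/
abbrev contract (N : C) : (N ⊗ A.X) ⊗ A.X ⟶ N :=
  (α_ N A.X A.X).hom ≫ N ◁ A.pairing ≫ (ρ_ N).hom

/-- The evaluation of `N ⊗ A`, the internal hom from `A ⊗ B` to `N`. -/
def pairingEv : (N.X ⊗ A.X) ⊙ₗ (A.X ⊙ₗ RightMod.regular B) ⟶ N :=
  (αₗ (N.X ⊗ A.X) A.X (RightMod.regular B)).inv ≫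
    A.contract N.X ⊵ₗ RightMod.regular B ≫ N.actHom

/-- Self-duality of `A` turns maps `X ⟶ N ⊗ A` into maps `X ⊗ A ⟶ N`, and freeness turns these into
module maps from `X ⊗ (A ⊗ B)` to `N`. -/
lemma pairingEv_bijective (X : C) : Function.Bijective fun g : X ⟶ N.X ⊗ A.X =>
    g ⊵ₗ (A.X ⊙ₗ RightMod.regular B) ≫ A.pairingEv N := by
  let _ := A.exactPairing
  have h₁ : Function.Bijective fun g : X ⟶ N.X ⊗ A.X => g ▷ A.X ≫ A.contract N.X :=
    (tensorRightHomEquiv X A.X A.X N.X).symm.bijective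
  have h₂ := (N.actHom_bijective (X ⊗ A.X)).comp h₁
  have h₃ : Function.Bijective fun f : (X ⊗ A.X) ⊙ₗ RightMod.regular B ⟶ N =>
      (αₗ X A.X (RightMod.regular B)).inv ≫ f :=
    ⟨fun _ _ h => (cancel_epi _).1 h, fun f => ⟨(αₗ X A.X (RightMod.regular B)).hom ≫ f, by simp⟩⟩
  convert h₃.comp h₂ using 2 with g
  simp [pairingEv]

end

lemma isSplitEpi_act {B : Mon C} (N : RightMod B) : IsSplitEpi N.act :=
  ⟨⟨(ρ_ N.X).inv ≫ N.X ◁ MonObj.one, by rw [Category.assoc, N.act_one, Iso.inv_hom_id]⟩⟩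

/-- Identifies the composition through the regular module, from `N ⊗ (B ⊗ A)` to `N ⊗ A`, as the
action of `B` on `N`. -/
lemma pairingEv_act {B : Mon C} (N : RightMod B) :
    ((α_ N.X B.X A.X).inv ≫ N.act ▷ A.X) ⊵ₗ (A.X ⊙ₗ RightMod.regular B) ≫ A.pairingEv N =
      (αₗ _ _ _).hom ≫ N.X ⊴ₗ A.pairingEv (RightMod.regular B) ≫ N.actHom := by
  ext
  change ((α_ N.X B.X A.X).inv ≫ N.act ▷ A.X) ▷ (A.X ⊗ B.X) ≫
      (α_ (N.X ⊗ A.X) A.X B.X).inv ≫ A.contract N.X ▷ B.X ≫ N.act =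
    (α_ _ _ _).hom ≫ N.X ◁ ((α_ (B.X ⊗ A.X) A.X B.X).inv ≫ A.contract B.X ▷ B.X ≫ μ[B.X]) ≫ N.act
  rw [contract, contract]
  generalize A.pairing = p
  calc _ = 𝟙 _ ⊗≫ (N.act ▷ (A.X ⊗ A.X) ≫ N.X ◁ p) ▷ B.X ⊗≫ N.act := by monoidal
    _ = 𝟙 _ ⊗≫ ((N.X ⊗ B.X) ◁ p) ▷ B.X ⊗≫ N.act ▷ B.X ≫ N.act := by
        rw [← whisker_exchange]; monoidal
    _ = _ := by rw [N.act_act]; monoidal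

variable [HasCoequalizers C] [∀ X : C, PreservesColimitsOfSize.{0, 0} (tensorLeft X)]
  [∀ X : C, PreservesColimitsOfSize.{0, 0} (tensorRight X)]

/-- The free bimodule algebra `Φ(B)`, as an algebra in the ambient category. -/
noncomputable abbrev freeAlg (B : Mon C) : Mon C :=
  (Bimod.forgetBoth A.alg).mapMon.obj (A.free.mapMon.obj B)

lemma freeAlg_mul (B : Mon C) : MonObj.mul (X := (A.freeAlg B).X) =
    A.freeMulAux B.X B.X ≫ (A.X ◁ μ[B.X]) ▷ A.X := by
  change Bimod.proj _ _ ≫ (A.freeMul B.X B.X ≫ A.free.map μ[B.X]).hom = _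
  rw [Bimod.comp_hom', reassoc_of% A.proj_freeMul]
  rfl

/-- Both sides contract two adjacent pairs of factors `A` and multiply three factors `B`. Hence the
product of `Φ(B)` is the composition of internal endomorphisms of `A ⊗ B`. -/
lemma pairingEv_mul (B : Mon C) :
    MonObj.mul (X := (A.freeAlg B).X) ⊵ₗ (A.X ⊙ₗ RightMod.regular B) ≫
        A.pairingEv (A.X ⊙ₗ RightMod.regular B) =
      (αₗ _ _ _).hom ≫ (A.freeAlg B).X ⊴ₗ A.pairingEv (A.X ⊙ₗ RightMod.regular B) ≫
        A.pairingEv (A.X ⊙ₗ RightMod.regular B) := by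
  rw [freeAlg_mul, freeMulAux_eq]
  ext
  change ((𝟙 _ ⊗≫ (A.X ⊗ B.X) ◁ A.pairing ▷ (B.X ⊗ A.X) ⊗≫ 𝟙 _) ≫ (A.X ◁ μ[B.X]) ▷ A.X) ▷
      (A.X ⊗ B.X) ≫ (α_ ((A.X ⊗ B.X) ⊗ A.X) A.X B.X).inv ≫ A.contract (A.X ⊗ B.X) ▷ B.X ≫
        (α_ A.X B.X B.X).hom ≫ A.X ◁ μ[B.X] =
    (α_ ((A.X ⊗ B.X) ⊗ A.X) ((A.X ⊗ B.X) ⊗ A.X) (A.X ⊗ B.X)).hom ≫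
      ((A.X ⊗ B.X) ⊗ A.X) ◁ ((α_ ((A.X ⊗ B.X) ⊗ A.X) A.X B.X).inv ≫
        A.contract (A.X ⊗ B.X) ▷ B.X ≫ (α_ A.X B.X B.X).hom ≫ A.X ◁ μ[B.X]) ≫
      (α_ ((A.X ⊗ B.X) ⊗ A.X) A.X B.X).inv ≫ A.contract (A.X ⊗ B.X) ▷ B.X ≫
        (α_ A.X B.X B.X).hom ≫ A.X ◁ μ[B.X]
  rw [contract]
  generalize A.pairing = p
  calc _ = 𝟙 _ ⊗≫ (A.X ⊗ B.X) ◁ p ▷ (B.X ⊗ A.X ⊗ A.X ⊗ B.X) ⊗≫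
          A.X ◁ (μ[B.X] ▷ (A.X ⊗ A.X) ≫ B.X ◁ p) ▷ B.X ⊗≫ A.X ◁ μ[B.X] := by monoidal
    _ = 𝟙 _ ⊗≫ (A.X ⊗ B.X) ◁ (p ▷ (B.X ⊗ (A.X ⊗ A.X) ⊗ B.X) ≫ 𝟙_ C ◁ (B.X ◁ p ▷ B.X)) ⊗≫
          A.X ◁ (μ[B.X] ▷ B.X ≫ μ[B.X]) := by
        rw [← whisker_exchange]; monoidal
    _ = 𝟙 _ ⊗≫ (A.X ⊗ B.X) ◁ ((A.X ⊗ A.X) ◁ (B.X ◁ p ▷ B.X)) ⊗≫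
          (A.X ⊗ B.X) ◁ (p ▷ (B.X ⊗ B.X) ≫ 𝟙_ C ◁ μ[B.X]) ⊗≫ A.X ◁ μ[B.X] := by
        rw [← whisker_exchange, MonObj.mul_assoc]; monoidal
    _ = _ := by rw [← whisker_exchange]; monoidal

/-- The context has the modules `B` and `A ⊗ B` as objects. The composition into `B` is the
contraction by the pairing followed by the multiplication, and the composition into `(A ⊗ B) ⊗ A` is
the action tensored with `A`; both are epi. -/
lemma moritaEquivalent_freeAlg [IsRegularEpiCategory C] [IsSplitEpi A.pairing] (B : Mon C) :
    MoritaEquivalent B (A.freeAlg B) := by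
  have hc (N : C) : Epi (A.contract N) := by
    have : Epi (N ◁ A.pairing) := epi_whiskerLeft _ _
    infer_instance
  have : IsRegularEpi (A.pairingEv (RightMod.regular B)).hom := by
    have : Epi (A.contract B.X ▷ B.X) := epi_whiskerRight _ _
    have : IsSplitEpi μ[B.X] := isSplitEpi_act (RightMod.regular B)
    have h : Epi ((α_ (B.X ⊗ A.X) A.X B.X).inv ≫ A.contract B.X ▷ B.X ≫ μ[B.X]) := inferInstance
    exact @IsRegularEpiCategory.regularEpiOfEpi C _ _ _ _ _ h
  let K : RightMod B := A.X ⊙ₗ RightMod.regular B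
  have : IsSplitEpi K.act := isSplitEpi_act K
  have : Epi (K.act ▷ A.X) := epi_whiskerRight _ _
  let c : K.X ⊗ (B.X ⊗ A.X) ⟶ (A.freeAlg B).X := (α_ K.X B.X A.X).inv ≫ K.act ▷ A.X
  have : IsRegularEpi c :=
    have h : Epi ((α_ K.X B.X A.X).inv ≫ K.act ▷ A.X) := inferInstance
    @IsRegularEpiCategory.regularEpiOfEpi C _ _ _ _ _ h
  obtain ⟨_, h₁, h₂, h₃, h₄⟩ := RightMod.exists_enrichedCategory (B' := A.freeAlg B)
    (A.pairingEv (RightMod.regular B)) (A.pairingEv K) (A.pairingEv_bijective _)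
    (A.pairingEv_bijective K) (A.pairingEv_mul B) c (A.pairingEv_act K)
  have := (IsRegularEpi.getStruct (eComp C false true false)).epi
  have := (IsRegularEpi.getStruct (eComp C true false true)).epi
  have := (isEnrichedGenerator_false (C := C)).moritaEquivalent isEnrichedGenerator_true
  rwa [h₁, h₂] at this

end FrobAlg

/-! ### Transport of Morita contexts along `Φ` and along the forgetful functor -/

namespace FrobAlg

variable {C : Type*} [Category* C] [MonoidalCategory C] (A : FrobAlg C)
  [∀ X : C, PreservesColimitsOfSize.{0, 0} (tensorLeft X)]
  [∀ X : C, PreservesColimitsOfSize.{0, 0} (tensorRight X)]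

/-- Apart from structural isomorphisms the map is the tensored pairing, a split epimorphism. -/
lemma epi_freeMulAux [IsSplitEpi A.pairing] (X Y : C) : Epi (A.freeMulAux X Y) := by
  have := epi_whiskerRight Y A.pairing
  have := epi_whiskerLeft (A.X ⊗ X) (A.pairing ▷ Y)
  have : Epi (((A.X ⊗ X) ◁ A.pairing ▷ Y) ▷ A.X) := epi_whiskerRight _ _
  rw [freeMulAux]
  infer_instance

variable [HasCoequalizers C]

/-- An object through which all identities of an enriched category factor locally is a generator
of the image of the enriched category under `Φ`. -/
lemma isEnrichedGenerator_free [IsRegularEpiCategory C] [IsSplitEpi A.pairing] {ι : Type*}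
    [EnrichedCategory C ι] {i : ι} (h : ∀ j, Epi (eComp C j i j)) :
    IsEnrichedGenerator (Bimod A.alg A.alg) (ι := TransportEnrichment A.free ι) i := by
  refine Bimod.isEnrichedGenerator (isEnrichedGenerator_of_epi fun j : ι => ?_)
  -- The composition after transport along `Φ` and then along the forgetful functor.
  change Epi (Bimod.proj _ _ ≫ (A.freeMul _ _ ≫ A.free.map (eComp C j i j)).hom)
  rw [Bimod.comp_hom', reassoc_of% A.proj_freeMul]
  have := h j
  have := epi_whiskerLeft A.X (eComp C j i j)
  have := epi_whiskerRight A.X (A.X ◁ eComp C j i j)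
  have := A.epi_freeMulAux (j ⟶[C] i) (i ⟶[C] j)
  exact epi_comp (A.freeMulAux _ _) ((A.X ◁ eComp C j i j) ▷ A.X)

lemma moritaEquivalent_free [IsRegularEpiCategory C] [IsSplitEpi A.pairing] {B B' : Mon C}
    (h : MoritaEquivalent B B') :
    MoritaEquivalent (A.free.mapMon.obj B) (A.free.mapMon.obj B') := by
  obtain ⟨_, rfl, rfl, _, _⟩ := h.exists_enrichedCategory
  have := (IsRegularEpi.getStruct (eComp C false true false)).epi
  have := (IsRegularEpi.getStruct (eComp C true false true)).epi
  exact IsEnrichedGenerator.moritaEquivalent (ι := TransportEnrichment A.free Bool)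
    (i := false) (j := true)
    (A.isEnrichedGenerator_free fun | false => inferInstance | true => inferInstance)
    (A.isEnrichedGenerator_free fun | false => inferInstance | true => inferInstance)

end FrobAlg

/-- Morita equivalent algebras in a category of bimodules are Morita equivalent in the ambient
category. -/
lemma MoritaEquivalent.forgetBoth {C : Type*} [Category* C] [MonoidalCategory C] [HasCoequalizers C]
    [∀ X : C, PreservesColimitsOfSize.{0, 0} (tensorLeft X)]
    [∀ X : C, PreservesColimitsOfSize.{0, 0} (tensorRight X)] [IsRegularEpiCategory C]
    {A : Mon C} {R R' : Mon (Bimod A A)} (h : MoritaEquivalent R R') :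
    MoritaEquivalent ((Bimod.forgetBoth A).mapMon.obj R) ((Bimod.forgetBoth A).mapMon.obj R') := by
  obtain ⟨_, rfl, rfl, _, _⟩ := h.exists_enrichedCategory
  have h₁ := Bimod.epi_hom_of_isRegularEpi (eComp (Bimod A A) false true false)
  have h₂ := Bimod.epi_hom_of_isRegularEpi (eComp (Bimod A A) true false true)
  let _ : EnrichedCategory C Bool :=
    inferInstanceAs (EnrichedCategory C (TransportEnrichment (Bimod.forgetBoth A) Bool))
  have : Epi (eComp C false true false) :=
    epi_comp (Bimod.proj _ _) (eComp (Bimod A A) false true false).hom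
  have : Epi (eComp C true false true) :=
    epi_comp (Bimod.proj _ _) (eComp (Bimod A A) true false true).hom
  exact (isEnrichedGenerator_false (C := C)).moritaEquivalent isEnrichedGenerator_true

theorem theorem4p7 {𝕜 : Type*} [Field 𝕜] {C : Type*} [Category* C] [Abelian C] [Linear 𝕜 C]
    [MonoidalCategory C] [RigidCategory C] (A : FrobAlg C) (hA : A.IsSpecial 𝕜) (B B' : Mon C) :
    MoritaEquivalent B B' ↔
      MoritaEquivalent (A.free.mapMon.obj B) (A.free.mapMon.obj B') := by
  have := A.isSplitEpi_pairing hA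
  exact ⟨A.moritaEquivalent_free, fun h => (A.moritaEquivalent_freeAlg B).trans
    (h.forgetBoth.trans (A.moritaEquivalent_freeAlg B').symm)⟩
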